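/- Write $\log=\log_2$. Let $0<\varepsilon<1$, $k=\lceil 8.02/\varepsilon^2\rceil$, $l'=80+2\log(1/\varepsilon)$, let $p$ be a prime with $p>u$ and $p\ge k$, and let $X=\{x_1,\dots,x_b\}\subseteq\{1,\dots,u\}$ be a set of $b\ge 1$ distinct items. Choose the $2(d+1)$ coefficients of two polynomials $f(x)=\sum_{l=0}^{d}a_lx^l$ and $g(x)=\sum_{l=0}^{d}b_lx^l$ over $\mathbb Z_p$ independently and uniformly at random, where $d>l'$ and $d=O(\log(1/\varepsilon))$, and let $h_i(x)=(f(x)+i\,g(x)) \bmod p\in\{0,\dots,p-1\}$ for $0\le i<k$. Put $t=12\,p\,l'/b$. The procedure block-update starts with $m_i=\infty$, $p_i=0$ for all rows $i<k$. For each item $x_j$ in turn it evaluates $f(x_j)$ and $g(x_j)$, computes the list of all indices $i<k$ with $h_i(x_j)\le t$ together with the values $h_i(x_j)$, and for each such $i$ with $m_i>h_i(x_j)$ it sets $m_i:=h_i(x_j)$, $p_i:=x_j$. The small values are found by the following recursion for the progression $(a+ib)\bmod n$, $i<k$, with integer threshold $T$, which lists the elements smaller than $T$ (at the top level $a=f(x_j)$,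 $b=g(x_j)$, $n=p$ and $T=\min(p,\lfloor t\rfloor+1)$): if $k\le1$ or $b=0$, answer directly; if $b<T$, scan the beginning of each run between two consecutive wrap-arounds modulo $n$; if $T\le b$ and $b>n/2$, reverse the progression; otherwise recurse on the elements smaller than $b$, which form a progression modulo $b$ with step $(-n)\bmod b$. The index of a value $v$ is recovered as $(v-f(x_j))\,g(x_j)^{-1}$ in $\mathbb Z_p$ if $g(x_j)\ne 0$. Time is the number of elementary steps: integer arithmetic (including division and $\bmod$), arithmetic in $\mathbb Z_p$ (including inversion, by table lookup), comparisons, array accesses and list insertions each cost one step. The block fingerprint is computed correctly if after the procedure, for every $i<k$, $p_i\in X$ minimizes $h_i$ over $X$ and $m_i=h_i(p_i)$. **Theorem.** For all real $\varepsilon_0<1$ and $D$ there is a constant $C>0$ such that for all $0<\varepsilon\le\varepsilon_0$, all $d$ with $l'<d\le D\log(1/\varepsilon)$, and all $p,u,X$ as above: 1. The block fingerprint is computed incorrectly with probability less than $2^{-29}$; block-update takes more than $C\left(b\log\frac1\varepsilon+\frac1{\varepsilon^2}\log\frac1\varepsilon\right)$ steps with probability less than $\frac1{100}$; hence the probability that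 it is not both correct and within this time is less than $2^{-29}+\frac1{100}$. 2. For every $\delta_0<1$ there is a constant $C_1>0$, depending only on $\varepsilon_0,D,\delta_0$, such that for all $0<\delta\le\delta_0$ the following holds. Run block-update for $\lceil 4\log(1/\delta)\rceil$ blocks with independent random choices of $(f,g)$, dropping every block that needs more than $\left\lfloor C\left(b\log\frac1\varepsilon+\frac1{\varepsilon^2}\log\frac1\varepsilon\right)\right\rfloor$ steps. Then the total time is always at most $C_1\log\frac1\delta\left(b\log\frac1\varepsilon+\frac1{\varepsilon^2}\log\frac1\varepsilon\right)$, and each single block is dropped or incorrect with probability less than $2^{-29}+\frac1{100}$. -/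

import Mathlib

/-! ## Step counting

Running times are measured on a unit-cost random access machine.  A computation is a value together
with the number of elementary steps spent on it.  One step is charged for each arithmetic operation
on integers (`+`, `-`, `*`, integer division rounded down or up, `mod`), each operation of the field
`ZMod p` (inverses are looked up in a table), each comparison, each array read or write, and each
item appended to a list. -/

/-- A value together with the number of elementary steps used to compute it. -/
structure Timed (α : Type) where
  val : α
  time : ℕ

instance : Monad Timed where
  pure a := ⟨a, 0⟩
  bind c f := ⟨(f c.val).val, c.time + (f c.val).time⟩

/-- Charge `n` elementary steps. -/
def tick (n : ℕ) : Timed Unit := ⟨(), n⟩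

/-- Run a computation with a step budget `B`; it is abandoned, with result `none`, as soon as the
budget is used up without the computation having finished. -/
def Timed.within {α : Type} (B : ℕ) (c : Timed α) : Timed (Option α) :=
  if c.time ≤ B then ⟨some c.val, c.time⟩ else ⟨none, B⟩

/-! ## Small elements of an arithmetic progression modulo `n`

The progression is `(a + i * b) % n` for `i = 0, …, k - 1`. -/

/-- The loop `while j < k and v < t: append v; j = j + 1; v = v + b`, returning the final
`(j, v, list)`. -/
def scanRun (b k t : ℕ) (j v : ℕ) (acc : List ℕ) : Timed (ℕ × ℕ × List ℕ) := do
  tick 2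
  if j < k ∧ v < t then do
    tick 3
    scanRun b k t (j + 1) (v + b) (acc ++ [v])
  else pure (j, v, acc)
termination_by k - j

/-- The loop `while j < k: v = (a + j * b) % n; (scan the run starting at j); j = j + ⌈(n - v) / b⌉`,
which goes from one wrap-around of the progression to the next.  The first argument
bounds the number of iterations; it is started at `k`, and `j` grows in each iteration. -/
def scanFlips (a b n k t : ℕ) : ℕ → ℕ → List ℕ → Timed (List ℕ)
  | 0, _, acc => pure acc
  | fuel + 1, j, acc => do
    tick 1
    if j < k then do
      tick 3
      let r ← scanRun b k t j ((a + j * b) % n) acc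
      tick 3
      scanFlips a b n k t fuel (r.1 + (n - r.2.1) ⌈/⌉ b) r.2.2
    else pure acc

/-- The recursive procedure that lists (with multiplicity, in some order) the elements smaller than
`t` of the progression `(a + i * b) % n`, `i < k`, for `a, b < n` and `t ≤ n`.
* Short progressions and step `0` are handled directly.
* If `b < t`, all runs between wrap-arounds are scanned.
* If `b > n / 2`, the progression is reversed.
* Otherwise only elements smaller than `b` matter; these are the elements just after a
  wrap-around and possibly the first one, and they form a progression with step `-n` modulo `b`. -/
def psMin (a b n k t : ℕ) : Timed (List ℕ) := do
  tick 1
  if k ≤ 1 then do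
    tick 3
    pure (if k = 1 ∧ a < t then [a] else [])
  else do
    tick 1
    if hb : b = 0 then do
      tick 1
      if a < t then do
        tick k
        pure (List.replicate k a)
      else pure []
    else do
      tick 1
      if b < t then do
        let r ← scanRun b k t 0 a []
        tick 2
        scanFlips a b n k t k ((n - a) ⌈/⌉ b) r.2.2
      else do
        tick 2
        if hn : n < 2 * b then do
          tick 5
          psMin ((a + (k - 1) * b) % n) (n - b) n k t
        else do
          tick 8
          if a < b then do
            tick 1
            psMin a ((b - n % b) % b) b ((a + b * (k - 1)) / n + 1) t
          else do
            tick 5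
            psMin ((a + ((n - a) ⌈/⌉ b) * b) % n) ((b - n % b) % b) b ((a + b * (k - 1)) / n) t
termination_by 2 * n + (if n < 2 * b then 1 else 0)
decreasing_by
  all_goals simp_wf
  all_goals split_ifs <;> omega

/-! ## The hashes -/

/-- The random choices for one block: the coefficients of two polynomials `f`, `g` over `ZMod p`
of the form `c 0 + c 1 * x + ⋯ + c d * x ^ d`. -/
abbrev Seed (p d : ℕ) : Type := (Fin (d + 1) → ZMod p) × (Fin (d + 1) → ZMod p)

/-- The polynomial with coefficients `c`, evaluated at `x`. -/
def polyVal {p d : ℕ} (c : Fin (d + 1) → ZMod p) (x : ZMod p) : ZMod p :=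
  ∑ l : Fin (d + 1), c l * x ^ (l : ℕ)

/-- The hash `h_i(x) = f(x) + i * g(x)`, as an integer in `{0, …, p - 1}`. -/
def hashVal {p d : ℕ} (ω : Seed p d) (i x : ℕ) : ℕ :=
  (polyVal ω.1 (x : ZMod p) + (i : ZMod p) * polyVal ω.2 (x : ZMod p)).val

/-- Step-counted evaluation of a polynomial, given by its list of coefficients, by Horner's rule. -/
def horner {p : ℕ} (x : ZMod p) : List (ZMod p) → Timed (ZMod p)
  | [] => pure 0
  | c :: cs => do
    let r ← horner x cs
    tick 3
    pure (c + x * r)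

/-! ## The block update -/

/-- `pr-small-val`: the values `h_i(x)`, `i < k`, that are smaller than the integer `T`. -/
def prSmallVal {p d : ℕ} (ω : Seed p d) (k x T : ℕ) : Timed (List ℕ) := do
  let a ← horner (x : ZMod p) (List.ofFn ω.1)
  let b ← horner (x : ZMod p) (List.ofFn ω.2)
  psMin a.val b.val p k T

/-- `pr-small-loc`: the indices `i < k` with `h_i(x) < T`, in the order of `prSmallVal`.  The index
of a value `v` is the solution of `v = f(x) + i * g(x)` in `ZMod p`; `g(x)` is inverted once.  If
`g(x) = 0` the progression is constant, so that either every index or none is returned. -/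
def prSmallLoc {p d : ℕ} (ω : Seed p d) (k x T : ℕ) : Timed (List ℕ) := do
  let a ← horner (x : ZMod p) (List.ofFn ω.1)
  let b ← horner (x : ZMod p) (List.ofFn ω.2)
  let V ← psMin a.val b.val p k T
  tick 1
  if b = 0 then do
    tick V.length
    pure (List.range V.length)
  else do
    tick (1 + 4 * V.length)
    pure (V.map fun v => (((v : ZMod p) - a) * b⁻¹).val)

/-- The two arrays of a block: for row `i`, the smallest value seen so far (initially `∞`) and the
item at which it occurs (initially `0`). -/
structure BlockState where
  minVal : ℕ → ℕ∞
  argMin : ℕ → ℕ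

/-- Update the rows listed in `L` (pairs of an index and a value) for the item `x`. -/
def updateRows (x : ℕ) : List (ℕ × ℕ) → BlockState → Timed BlockState
  | [], s => do
    tick 1
    pure s
  | y :: L, s => do
    tick 5
    if (y.2 : ℕ∞) < s.minVal y.1 then do
      tick 2
      updateRows x L ⟨Function.update s.minVal y.1 y.2, Function.update s.argMin y.1 x⟩
    else updateRows x L s

/-- Process the items one after the other. -/
def processItems {p d : ℕ} (ω : Seed p d) (k T : ℕ) : List ℕ → BlockState → Timed BlockState
  | [], s => do
    tick 1
    pure s
  | x :: xs, s => do
    tick 2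
    let I ← prSmallLoc ω k x T
    let V ← prSmallVal ω k x T
    let s₁ ← updateRows x (I.zip V) s
    processItems ω k T xs s₁

/-- The integer `T` such that, for `v ∈ {0, …, p - 1}`, one has `v ≤ t` if and only if `v < T`. -/
noncomputable def intThreshold (p : ℕ) (t : ℝ) : ℕ := min p (⌊t⌋₊ + 1)

/-- The procedure `block-update((x_1, …, x_b), f, g, k, t)`. -/
noncomputable def blockUpdate {p d : ℕ} (xs : List ℕ) (ω : Seed p d) (k : ℕ) (t : ℝ) :
    Timed BlockState := do
  tick 3
  tick (2 * k)
  processItems ω k (intThreshold p t) xs ⟨fun _ => ⊤, fun _ => 0⟩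

/-- The state `s` is the correct block fingerprint of the items `xs`: in each of the `k` rows,
`argMin` holds an item of `xs` minimizing `h_i` over `xs`, and `minVal` holds the minimum. -/
def IsBlockFingerprint {p d : ℕ} (xs : List ℕ) (ω : Seed p d) (k : ℕ) (s : BlockState) : Prop :=
  ∀ i < k, s.argMin i ∈ xs ∧ (∀ x ∈ xs, hashVal ω i (s.argMin i) ≤ hashVal ω i x) ∧
    s.minVal i = (hashVal ω i (s.argMin i) : ℕ∞)

/-- Run the block update for `m` seeds one after the other, dropping every block that needs more
than `B` steps. -/
noncomputable def allBlocks {p d m : ℕ} (xs : List ℕ) (ω : Fin m → Seed p d) (k : ℕ) (t : ℝ)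
    (B : ℕ) : Timed (Fin m → Option BlockState) :=
  ⟨fun r => ((blockUpdate xs (ω r) k t).within B).val,
   ∑ r, ((blockUpdate xs (ω r) k t).within B).time⟩

/-! ## Parameters and probability -/

/-- The number of hashes in a block, `k = 8.02 / ε ^ 2`, rounded up. -/
noncomputable def numHashes (ε : ℝ) : ℕ := ⌈8.02 / ε ^ 2⌉₊

/-- `l' = 80 + 2 log₂ (1 / ε)`. -/
noncomputable def ellPrime (ε : ℝ) : ℝ := 80 + 2 * Real.logb 2 (1 / ε)

/-- The threshold `t = 12 p l' / b`. -/
noncomputable def threshold (p b : ℕ) (ε : ℝ) : ℝ := 12 * p * ellPrime ε / b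

/-- The number of blocks, `4 log₂ (1 / δ)`, rounded up. -/
noncomputable def numBlocks (δ : ℝ) : ℕ := ⌈4 * Real.logb 2 (1 / δ)⌉₊

/-- The time bound `b log (1 / ε) + (1 / ε ^ 2) log (1 / ε)` for one block, without its constant. -/
noncomputable def blockTime (b : ℕ) (ε : ℝ) : ℝ :=
  b * Real.logb 2 (1 / ε) + 1 / ε ^ 2 * Real.logb 2 (1 / ε)

/-- The probability of an event under the uniform distribution on a finite type. -/
noncomputable def unifProb {Ω : Type} [Fintype Ω] [Nonempty Ω] (E : Set Ω) : ℝ :=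
  ((PMF.uniformOfFintype Ω).toOuterMeasure E).toReal

/-!
The running time and the correctness of `block-update` both reduce to facts about the hashes of the
items that are smaller than the threshold `T`, the *small* hashes.

**A fixed seed.** `psMin` lists exactly the small elements of a progression (`psMin_spec`).  When the
step is smaller than the threshold, each run between two wrap-arounds starts with a small element, so
scanning costs a constant per listed element plus a constant.  Otherwise the elements smaller than the
step form a progression of at most half the length (`smallElems_step`), possibly after one reversal,
so the recursion adds `O(log k)` steps.  An item thus costs `O(d + log k)` steps plus a constant per
small hash (`blockUpdate_time`), and the fingerprint is correct as soon as every row contains a small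
hash (`isBlockFingerprint_blockUpdate`).

**Running time.** Each hash is uniform in `ZMod p`, so the expected number of small hashes is
`b * k * T / p`, which is `O(ε⁻² log (1 / ε))`; Markov's inequality bounds the probability that the
running time exceeds `101` times the bound on its mean (`unifProb_time_lt`).

**Correctness.** In one row the hashes of any `d + 1` items are independent (`expect_prod_rowVal`), by
Lagrange interpolation.  Split the items into `r = ⌊ℓ' / 2⌋` groups of equal size, leaving out a
remainder, so that a group has `μ ≥ 16` small hashes in the mean.  If the row has no small hash, then
the product over the groups of the squared deviations from `μ` equals `μ ^ (2 * r)`.  This product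
involves at most `2 * r ≤ d + 1` items in each of its monomials, so its mean is a product of
variances and at most `μ ^ r`.  Hence the row fails with probability at most
`μ ^ (-r) ≤ 16 ^ (-r)` (`unifProb_row_le`), which beats the number of rows.
-/

/-! ### Small elements of an arithmetic progression -/

@[simp] theorem Timed.val_bind {α β : Type} (c : Timed α) (f : α → Timed β) :
    (c >>= f).val = (f c.val).val := rfl

@[simp] theorem Timed.time_bind {α β : Type} (c : Timed α) (f : α → Timed β) :
    (c >>= f).time = c.time + (f c.val).time := rfl

@[simp] theorem Timed.val_pure {α : Type} (a : α) : (pure a : Timed α).val = a := rfl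

@[simp] theorem Timed.time_pure {α : Type} (a : α) : (pure a : Timed α).time = 0 := rfl

@[simp] theorem tick_time (n : ℕ) : (tick n).time = n := rfl

/-- One unfolding of the recursion, for the computed list. -/
theorem psMin_val (a b n k t : ℕ) : (psMin a b n k t).val =
    if k ≤ 1 then (if k = 1 ∧ a < t then [a] else []) else
    if b = 0 then (if a < t then List.replicate k a else []) else
    if b < t then (scanFlips a b n k t k ((n - a) ⌈/⌉ b) (scanRun b k t 0 a []).val.2.2).val else
    if n < 2 * b then (psMin ((a + (k - 1) * b) % n) (n - b) n k t).val else
    if a < b then (psMin a ((b - n % b) % b) b ((a + b * (k - 1)) / n + 1) t).val else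
    (psMin ((a + ((n - a) ⌈/⌉ b) * b) % n) ((b - n % b) % b) b ((a + b * (k - 1)) / n) t).val := by
  rw [psMin]
  split_ifs <;> simp [*]

/-- One unfolding of the recursion, for the number of steps. -/
theorem psMin_time (a b n k t : ℕ) : (psMin a b n k t).time =
    if k ≤ 1 then 4 else
    if b = 0 then (if a < t then 3 + k else 3) else
    if b < t then 5 + (scanRun b k t 0 a []).time +
      (scanFlips a b n k t k ((n - a) ⌈/⌉ b) (scanRun b k t 0 a []).val.2.2).time else
    if n < 2 * b then 10 + (psMin ((a + (k - 1) * b) % n) (n - b) n k t).time else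
    if a < b then 14 + (psMin a ((b - n % b) % b) b ((a + b * (k - 1)) / n + 1) t).time else
    18 + (psMin ((a + ((n - a) ⌈/⌉ b) * b) % n) ((b - n % b) % b) b
      ((a + b * (k - 1)) / n) t).time := by
  rw [psMin]
  split_ifs <;> simp [*] <;> omega

/-- The elements smaller than `t` of the progression `(a + i * b) % n`, `j ≤ i < k`, in order. -/
def smallElems (a b n t j k : ℕ) : List ℕ :=
  ((List.Ico j k).map fun i => (a + i * b) % n).filter (· < t)

theorem smallElems_append {a b n t j m k : ℕ} (h₁ : j ≤ m) (h₂ : m ≤ k) :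
    smallElems a b n t j m ++ smallElems a b n t m k = smallElems a b n t j k := by
  simp [smallElems, ← List.Ico.append_consecutive h₁ h₂]

theorem smallElems_eq_nil {a b n t j k : ℕ} (h : ∀ i, j ≤ i → i < k → t ≤ (a + i * b) % n) :
    smallElems a b n t j k = [] := by
  simp only [smallElems, List.filter_eq_nil_iff, List.mem_map, List.Ico.mem]
  rintro _ ⟨i, ⟨h1, h2⟩, rfl⟩
  simpa using h i h1 h2

/-- The scan appends `m` consecutive terms, where it stops at the first term that is not smaller
than `t` or at the end of the progression. -/
theorem scanRun_spec (b k t : ℕ) : ∀ (j v : ℕ) (acc : List ℕ), j ≤ k → ∃ m, j + m ≤ k ∧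
    (scanRun b k t j v acc).val = (j + m, v + m * b, acc ++ (List.range m).map fun i => v + i * b) ∧
    (∀ i < m, v + i * b < t) ∧ (j + m < k → t ≤ v + m * b) ∧
    (scanRun b k t j v acc).time = 2 + 5 * m := by
  intro j
  induction h : k - j generalizing j with
  | zero =>
    intro v acc hj
    refine ⟨0, by omega, ?_, by simp, by omega, ?_⟩ <;>
    · rw [scanRun]
      have : ¬ (j < k ∧ v < t) := by omega
      simp [this]
  | succ r ih =>
    intro v acc hj
    by_cases hc : j < k ∧ v < t
    · obtain ⟨m, h1, h2, h3, h4, h5⟩ := ih (j + 1) (by omega) (v + b) (acc ++ [v]) (by omega)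
      refine ⟨m + 1, by omega, ?_, ?_, ?_, ?_⟩
      · rw [scanRun]
        simp only [hc, Timed.val_bind, and_self, if_true, h2, List.range_succ_eq_map]
        simp only [List.append_assoc, List.map_cons, List.map_map]
        refine Prod.ext (by simp; omega) (Prod.ext (by simp; ring) ?_)
        simp only [List.singleton_append, zero_mul, add_zero, List.append_cancel_left_eq,
          List.cons.injEq, true_and]
        refine List.map_congr_left fun i _ => ?_
        simp only [Function.comp, Nat.succ_eq_add_one]
        ring
      · rintro (_ | i) hi
        · simpa using hc.2
        · have := h3 i (by omega)
          rw [add_mul]; omega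
      · intro hlt
        have := h4 (by omega)
        rw [add_mul]; omega
      · rw [scanRun]
        simp only [hc, Timed.time_bind, and_self, if_true, h5, tick_time]
        ring
    · refine ⟨0, by omega, ?_, by simp, by simp; omega, ?_⟩ <;>
      · rw [scanRun]
        simp [hc]

theorem progression_add (a b n j i : ℕ) :
    (a + (j + i) * b) % n = ((a + j * b) % n + i * b) % n := by
  rw [Nat.mod_add_mod]; congr 1; ring

/-- Starting from `v < n`, the first multiple of the step `b` that reaches `n` overshoots by less
than `b`. -/
theorem wrap_bounds {v b n : ℕ} (hb : 0 < b) (hv : v < n) :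
    n ≤ v + (n - v) ⌈/⌉ b * b ∧ v + (n - v) ⌈/⌉ b * b < n + b := by
  have h1 := (ceilDiv_le_iff_le_mul (b := n - v) (c := (n - v) ⌈/⌉ b) hb).1 le_rfl
  have h2 := (ceilDiv_le_iff_le_mul (b := n - v) (c := (n - v) ⌈/⌉ b - 1) hb).not.1
  have h3 := (ceilDiv_le_iff_le_mul (b := n - v) (c := 0) hb).not.2 (by omega)
  generalize (n - v) ⌈/⌉ b = q at *
  obtain ⟨e, rfl⟩ : ∃ e, q = e + 1 := ⟨q - 1, by omega⟩
  have h4 := h2 (by omega)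
  rw [Nat.add_sub_cancel] at h4
  rw [mul_add, mul_one] at h1
  rw [add_mul, one_mul, mul_comm e b]
  omega

/-- From index `j`, the progression first wraps around after `(n - v) ⌈/⌉ b` steps, where `v` is its
value at `j`; the value is then smaller than `b`.  Before that, its elements smaller than `t` are
those listed by a scan. -/
theorem run_spec {a b n k t j m : ℕ} (hb : 0 < b) (hbn : b < n) (ht : t ≤ n) (hm : j + m ≤ k)
    (h1 : ∀ i < m, (a + j * b) % n + i * b < t)
    (h2 : j + m < k → t ≤ (a + j * b) % n + m * b) :
    1 ≤ (n - (a + j * b) % n) ⌈/⌉ b ∧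
    m + (n - ((a + j * b) % n + m * b)) ⌈/⌉ b = (n - (a + j * b) % n) ⌈/⌉ b ∧
    (a + (j + (n - (a + j * b) % n) ⌈/⌉ b) * b) % n < b ∧
    (List.range m).map (fun i => (a + j * b) % n + i * b) ++
      smallElems a b n t (j + (n - (a + j * b) % n) ⌈/⌉ b) k = smallElems a b n t j k := by
  have hv : (a + j * b) % n < n := Nat.mod_lt _ (by omega)
  have hadd := progression_add a b n j
  generalize (a + j * b) % n = v at *
  set q := (n - v) ⌈/⌉ b with hq
  -- `e < q` if and only if the progression has not wrapped around after `e` more steps.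
  have hlt : ∀ e, e < q ↔ v + e * b < n := fun e => by
    rw [hq, ← not_le, ceilDiv_le_iff_le_mul hb, mul_comm]; omega
  have hmq : m ≤ q := by
    rcases Nat.eq_zero_or_pos m with rfl | hm0
    · omega
    · have := (hlt (m - 1)).2 (by have := h1 (m - 1) (by omega); omega)
      omega
  have hq1 : 1 ≤ q := (hlt 0).2 (by omega)
  obtain ⟨hge, hle⟩ := wrap_bounds hb hv
  refine ⟨hq1, ?_, ?_, ?_⟩
  · have h3 : ∀ e, (n - (v + m * b)) ⌈/⌉ b ≤ e ↔ q ≤ m + e := fun e => by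
      rw [ceilDiv_le_iff_le_mul hb, hq, ceilDiv_le_iff_le_mul hb, mul_add, mul_comm m b]; omega
    have h4 := (h3 _).1 le_rfl
    have h5 := (h3 (q - m)).2 (by omega)
    omega
  · rw [hadd, Nat.mod_eq_sub_mod hge, Nat.mod_eq_of_lt (by omega)]; omega
  · have e1 : (List.range m).map (fun i => v + i * b) = smallElems a b n t j (j + m) := by
      have : List.Ico j (j + m) = (List.range m).map (fun i => j + i) := by
        have := List.Ico.map_add 0 m j
        rw [List.Ico.zero_bot] at this
        rw [this]; simp [add_comm]
      rw [smallElems, this, List.map_map, List.filter_eq_self.2]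
      · refine List.map_congr_left fun i hi => ?_
        have := h1 i (List.mem_range.1 hi)
        simp only [Function.comp]
        rw [hadd, Nat.mod_eq_of_lt (by omega)]
      · simp only [List.mem_map, List.mem_range, Function.comp]
        rintro _ ⟨i, hi, rfl⟩
        have := h1 i hi
        rw [hadd, Nat.mod_eq_of_lt (by omega)]
        simpa using this
    have e2 : smallElems a b n t (j + m) (min (j + q) k) = [] := by
      refine smallElems_eq_nil fun i hi1 hi2 => ?_
      obtain ⟨e, rfl⟩ := Nat.exists_eq_add_of_le hi1
      rw [add_assoc, hadd, Nat.mod_eq_of_lt ((hlt _).1 (by omega))]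
      have := h2 (by omega)
      rw [add_mul]; omega
    have e3 : smallElems a b n t (j + q) k = smallElems a b n t (min (j + q) k) k := by
      rcases le_total (j + q) k with h | h
      · rw [min_eq_left h]
      · rw [min_eq_right h, smallElems_eq_nil (by omega), smallElems_eq_nil (by omega)]
    rw [e1, e3, ← List.append_nil (smallElems a b n t j (j + m)), ← e2,
      smallElems_append (by omega) (by omega), smallElems_append (by omega) (by omega)]

/-- When the step is smaller than the threshold, every run that starts at a wrap-around contributes
at least one small element, so that the cost is proportional to the number of elements listed. -/
theorem scanFlips_spec {a b n k t : ℕ} (hb : 0 < b) (hbt : b < t) (ht : t ≤ n) :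
    ∀ (fuel j : ℕ) (acc : List ℕ), k ≤ j + fuel → (a + j * b) % n < b →
      (scanFlips a b n k t fuel j acc).val = acc ++ smallElems a b n t j k ∧
      (scanFlips a b n k t fuel j acc).time ≤ 1 + 14 * (smallElems a b n t j k).length := by
  intro fuel
  induction fuel with
  | zero =>
    intro j acc hk _
    rw [smallElems_eq_nil (by omega)]
    simp [scanFlips]
  | succ fuel ih =>
    intro j acc hk hj
    by_cases hjk : j < k
    · obtain ⟨m, h1, h2, h3, h4, h5⟩ := scanRun_spec b k t j ((a + j * b) % n) acc hjk.le
      obtain ⟨g1, g2, g3, g4⟩ := run_spec hb (by omega) ht h1 h3 h4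
      -- The run starts below `b < t`, so that it contains a small element.
      have hm : 1 ≤ m := by
        by_contra hm
        obtain rfl : m = 0 := by omega
        have := h4 (by omega)
        omega
      obtain ⟨i1, i2⟩ := ih (j + (n - (a + j * b) % n) ⌈/⌉ b)
        (acc ++ (List.range m).map fun i => (a + j * b) % n + i * b) (by omega) g3
      rw [← g4]
      simp only [scanFlips, hjk, if_true, Timed.val_bind, Timed.time_bind, h2, h5, tick_time,
        add_assoc, g2]
      refine ⟨by rw [i1, List.append_assoc], ?_⟩
      simp only [List.length_append, List.length_map, List.length_range]
      omega
    · rw [smallElems_eq_nil (by omega)]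
      simp [scanFlips, hjk]

/-- The part of `psMin` that handles steps smaller than the threshold. -/
theorem scan_spec {a b n k t : ℕ} (ha : a < n) (hb : 0 < b) (hbt : b < t) (ht : t ≤ n) :
    (scanFlips a b n k t k ((n - a) ⌈/⌉ b) (scanRun b k t 0 a []).val.2.2).val =
      smallElems a b n t 0 k ∧
    (scanRun b k t 0 a []).time +
      (scanFlips a b n k t k ((n - a) ⌈/⌉ b) (scanRun b k t 0 a []).val.2.2).time ≤
      3 + 14 * (smallElems a b n t 0 k).length := by
  obtain ⟨m, h1, h2, h3, h4, h5⟩ := scanRun_spec b k t 0 a [] (Nat.zero_le k)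
  have e : (a + 0 * b) % n = a := by rw [zero_mul, add_zero, Nat.mod_eq_of_lt ha]
  have := run_spec (a := a) (j := 0) hb (hbt.trans_le ht) ht h1 (by rwa [e]) (by rwa [e])
  rw [e] at this
  simp only [zero_add] at this
  obtain ⟨g1, g2, g3, g4⟩ := this
  obtain ⟨i1, i2⟩ := scanFlips_spec (a := a) (k := k) hb hbt ht k ((n - a) ⌈/⌉ b)
    ((List.range m).map fun i => a + i * b) (by omega) g3
  simp only [h2, h5, List.nil_append]
  rw [← g4, i1]
  refine ⟨rfl, ?_⟩
  simp only [List.length_append, List.length_map, List.length_range]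
  omega

/-- The natural number `(b - n % b) % b` represents `-n` modulo `b`. -/
theorem step_add_mod_eq_zero {b n : ℕ} (hb : 0 < b) : ((b - n % b) % b + n) % b = 0 := by
  have := Nat.mod_lt n hb
  have hd := Nat.div_add_mod n b
  rw [Nat.mod_add_mod, show b - n % b + n = b * (n / b + 1) by rw [mul_add]; omega]
  simp

/-- The elements smaller than the step `b` are those just after a wrap-around modulo `n` and
possibly the first one; they form a progression with step `-n` modulo `b`. -/
theorem smallElems_step {a b n : ℕ} (ha : a < n) (hb : 0 < b) (hbn : b < n) (k : ℕ) :
    smallElems a b n b 0 (k + 1) =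
      (List.Ico (if a < b then 0 else 1) ((a + b * k) / n + 1)).map
        fun m => (a + m * ((b - n % b) % b)) % b := by
  induction k with
  | zero =>
    have : (a + b * 0) / n = 0 := by rw [mul_zero, add_zero, Nat.div_eq_of_lt ha]
    rw [this, smallElems]
    split_ifs with h <;> simp [Nat.mod_eq_of_lt ha, Nat.mod_eq_of_lt, h]
  | succ k ih =>
    rw [← smallElems_append (Nat.zero_le (k + 1)) (Nat.le_succ _), ih]
    have hn : 0 < n := by omega
    have e0 : a + b * (k + 1) = (a + b * k) + b := by ring
    have d1 := Nat.div_add_mod (a + b * k) n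
    have l1 := Nat.mod_lt (a + b * k) hn
    set w := (a + b * k) / n
    set r := (a + b * k) % n
    rw [e0]
    have hs : smallElems a b n b (k + 1) (k + 1 + 1) =
        if (a + b * k + b) % n < b then [(a + b * k + b) % n] else [] := by
      simp only [smallElems, List.Ico.succ_singleton, List.map_cons, List.map_nil,
        show a + (k + 1) * b = a + b * k + b by ring]
      split_ifs with h <;> simp [h]
    rw [hs]
    -- The index `k + 1` contributes an element smaller than `b` if and only if a wrap-around occurs.
    by_cases hw : r + b < n
    · have h1 : (a + b * k + b) % n = r + b := by
        rw [← d1, add_assoc, Nat.mul_add_mod, Nat.mod_eq_of_lt hw]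
      have h2 : (a + b * k + b) / n = w := by
        rw [← d1, add_assoc, Nat.mul_add_div hn, Nat.div_eq_of_lt hw, add_zero]
      rw [h1, h2]
      simp
    · have h1 : (a + b * k + b) % n = r + b - n := by
        rw [← d1, add_assoc, Nat.mul_add_mod, Nat.mod_eq_sub_mod (by omega),
          Nat.mod_eq_of_lt (by omega)]
      have h2 : (a + b * k + b) / n = w + 1 := by
        rw [← d1, add_assoc, Nat.mul_add_div hn, Nat.div_eq_sub_div hn (by omega),
          Nat.div_eq_of_lt (by omega)]
      have hs1 : (if a < b then 0 else 1) ≤ w + 1 := by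
        split_ifs
        exacts [Nat.zero_le _, Nat.le_add_left _ _]
      have hrb : r + b - n < b := by omega
      rw [h1, h2, if_pos hrb, List.Ico.succ_top hs1, List.map_append]
      congr 1
      simp only [List.map_cons, List.map_nil, List.cons.injEq, and_true]
      have hc := step_add_mod_eq_zero (n := n) hb
      set c := (b - n % b) % b
      have : (r + b - n + (w + 1) * (c + n)) % b = (r + b - n) % b := by
        rw [Nat.add_mod, Nat.mul_mod, hc]; simp
      have h3 : r + b - n + (w + 1) * (c + n) = a + (w + 1) * c + (k + 1) * b := by
        have : r + b - n + n = r + b := by omega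
        calc r + b - n + (w + 1) * (c + n) = (r + b - n + n) + (w + 1) * c + n * w := by ring
          _ = (n * w + r) + b + (w + 1) * c := by rw [this]; ring
          _ = _ := by rw [d1]; ring
      rw [h3, Nat.add_mul_mod_self_right, Nat.mod_eq_of_lt (show r + b - n < b by omega)] at this
      exact this.symm

theorem smallElems_filter {a b n s t j k : ℕ} (h : t ≤ s) :
    (smallElems a b n s j k).filter (· < t) = smallElems a b n t j k := by
  rw [smallElems, smallElems, List.filter_filter]
  refine List.filter_congr fun x _ => ?_
  simp only [← Bool.decide_and, decide_eq_decide]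
  omega

/-- Read backwards, the progression starts at its last element and has step `n - b`. -/
theorem smallElems_reverse {a b n t k : ℕ} (hb : b ≤ n) :
    (smallElems ((a + (k - 1) * b) % n) (n - b) n t 0 k).Perm (smallElems a b n t 0 k) := by
  refine List.Perm.filter _ ?_
  have hp : ((List.Ico 0 k).map fun i => k - 1 - i).Perm (List.Ico 0 k) := by
    refine (List.perm_ext_iff_of_nodup ?_ (List.Ico.nodup 0 k)).2 fun i => ?_
    · refine List.Nodup.map_on (fun x hx y hy h => ?_) (List.Ico.nodup 0 k)
      simp only [List.Ico.mem] at hx hy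
      omega
    · simp only [List.mem_map, List.Ico.mem]
      exact ⟨by rintro ⟨j, hj, rfl⟩; omega, fun h => ⟨k - 1 - i, by omega, by omega⟩⟩
  refine List.Perm.trans (List.Perm.of_eq ?_) (hp.map fun i => (a + i * b) % n)
  rw [List.map_map]
  refine List.map_congr_left fun i hi => ?_
  simp only [List.Ico.mem] at hi
  obtain ⟨e, rfl⟩ : ∃ e, k = e + i + 1 := ⟨k - 1 - i, by omega⟩
  obtain ⟨c, rfl⟩ := Nat.exists_eq_add_of_le hb
  simp only [Function.comp, Nat.mod_add_mod]
  rw [show e + i + 1 - 1 - i = e by omega, Nat.add_sub_cancel, Nat.add_sub_cancel_left,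
    show a + (e + i) * b + i * c = a + e * b + i * (b + c) by ring, Nat.add_mul_mod_self_right]

theorem smallElems_step_of_lt {a b n t : ℕ} (hab : a < b) (hbn : b < n) (ht : t ≤ b) (k : ℕ) :
    smallElems a b n t 0 (k + 1) =
      smallElems a ((b - n % b) % b) b t 0 ((a + b * k) / n + 1) := by
  rw [← smallElems_filter ht, smallElems_step (hab.trans hbn) (by omega) hbn, if_pos hab]
  rfl

theorem smallElems_step_of_le {a b n t : ℕ} (ha : a < n) (hb : 0 < b) (hab : b ≤ a)
    (hbn : b < n) (ht : t ≤ b) (k : ℕ) :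
    (a + (n - a) ⌈/⌉ b * b) % n < b ∧
    smallElems a b n t 0 (k + 1) =
      smallElems ((a + (n - a) ⌈/⌉ b * b) % n) ((b - n % b) % b) b t 0 ((a + b * k) / n) := by
  obtain ⟨h1, h2⟩ := wrap_bounds hb ha
  rw [Nat.mod_eq_sub_mod h1, Nat.mod_eq_of_lt (a := _ - n) (by omega)]
  refine ⟨by omega, ?_⟩
  rw [← smallElems_filter ht, smallElems_step ha hb hbn, if_neg (by omega), smallElems]
  congr 1
  generalize (a + b * k) / n = w
  have e := List.Ico.map_add 0 w 1
  rw [zero_add] at e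
  rw [← e, List.map_map]
  refine List.map_congr_left fun m _ => ?_
  have hc := step_add_mod_eq_zero (n := n) hb
  generalize (b - n % b) % b = c at *
  generalize (n - a) ⌈/⌉ b = q at *
  simp only [Function.comp]
  have e1 : (a + (1 + m) * c + q * b) % b = (a + (1 + m) * c) % b := Nat.add_mul_mod_self_right ..
  rw [← e1, show a + (1 + m) * c + q * b = (a + q * b - n + m * c) + (c + n) by
    rw [add_mul, one_mul]; omega, Nat.add_mod, hc, add_zero, Nat.mod_mod]

/-- `psMin` lists the small elements of the progression, in logarithmic time plus a constant number
of steps per listed element.  A non-scanning recursive call halves the number of elements, and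
two successive reversals do not occur. -/
theorem psMin_spec (a b n k t : ℕ) (ha : a < n) (hb : b < n) (ht : t ≤ n) :
    (psMin a b n k t).val.Perm (smallElems a b n t 0 k) ∧
    (psMin a b n k t).time ≤ 28 * Nat.clog 2 k + 8 + (if n < 2 * b then 10 else 0) +
      14 * (smallElems a b n t 0 k).length := by
  induction hN : 2 * n + (if n < 2 * b then 1 else 0) using Nat.strong_induction_on
    generalizing a b n k with
  | _ N ih =>
  subst hN
  rw [psMin_val, psMin_time]
  by_cases hk : k ≤ 1
  · rw [if_pos hk, if_pos hk]
    refine ⟨List.Perm.of_eq ?_, by omega⟩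
    obtain rfl | rfl : k = 0 ∨ k = 1 := by omega
    · simp [smallElems]
    · by_cases h : a < t <;> simp [smallElems, Nat.mod_eq_of_lt ha, h]
  rw [if_neg hk, if_neg hk]
  obtain ⟨k, rfl⟩ : ∃ l, k = l + 1 := ⟨k - 1, by omega⟩
  by_cases hb0 : b = 0
  · subst hb0
    rw [if_pos rfl, if_pos rfl]
    have e : smallElems a 0 n t 0 (k + 1) = if a < t then List.replicate (k + 1) a else [] := by
      simp only [smallElems, mul_zero, add_zero, Nat.mod_eq_of_lt ha, List.map_const',
        List.Ico.length, List.filter_replicate, decide_eq_true_eq, Nat.sub_zero]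
    rw [e]
    refine ⟨List.Perm.refl _, ?_⟩
    split_ifs <;> simp <;> omega
  have hb1 : 0 < b := Nat.pos_of_ne_zero hb0
  rw [if_neg hb0, if_neg hb0]
  by_cases hbt : b < t
  · rw [if_pos hbt, if_pos hbt]
    obtain ⟨h1, h2⟩ := scan_spec (k := k + 1) ha hb1 hbt ht
    rw [h1]
    exact ⟨List.Perm.refl _, by omega⟩
  rw [if_neg hbt, if_neg hbt]
  by_cases hr : n < 2 * b
  · rw [if_pos hr, if_pos hr, if_pos hr]
    have hp := smallElems_reverse (a := a) (t := t) (k := k + 1) hb.le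
    have hr' : ¬ n < 2 * (n - b) := by omega
    obtain ⟨h1, h2⟩ := ih _ (by rw [if_pos hr, if_neg hr']; omega)
      ((a + (k + 1 - 1) * b) % n) (n - b) n (k + 1) (Nat.mod_lt _ (by omega)) (by omega) ht rfl
    rw [if_neg hr', hp.length_eq] at h2
    exact ⟨h1.trans hp, by omega⟩
  rw [if_neg hr, if_neg hr, if_neg hr]
  rw [Nat.add_sub_cancel]
  have hc : (b - n % b) % b < b := Nat.mod_lt _ hb1
  have hd : (if b < 2 * ((b - n % b) % b) then 1 else 0) ≤ 1 ∧
    (if b < 2 * ((b - n % b) % b) then 10 else 0) ≤ 10 := by constructor <;> split_ifs <;> omega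
  -- Since `2 * b ≤ n`, the new progression has at most half as many elements, rounded up.
  have hclog : ∀ k', k' ≤ (k + 2) / 2 → Nat.clog 2 k' + 1 ≤ Nat.clog 2 (k + 1) := fun k' hk' => by
    rw [Nat.clog_of_two_le (n := k + 1) one_lt_two (by omega)]
    exact Nat.add_le_add_right (Nat.clog_mono_right 2 hk') 1
  have hw := Nat.div_mul_le_self (a + b * k) n
  have hbk : 2 * (b * k) ≤ n * k := by
    rw [← mul_assoc]; exact Nat.mul_le_mul_right k (by omega)
  by_cases hab : a < b
  · rw [if_pos hab, if_pos hab, smallElems_step_of_lt hab hb (by omega)]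
    obtain ⟨h1, h2⟩ := ih _ (by rw [if_neg hr]; omega) a ((b - n % b) % b) b
      ((a + b * k) / n + 1) hab hc (by omega) rfl
    refine ⟨h1, ?_⟩
    have := hclog ((a + b * k) / n + 1) (by
      have : (a + b * k) / n < (k + 2) / 2 := by
        rw [Nat.div_lt_iff_lt_mul (by omega)]
        have : k + 1 ≤ 2 * ((k + 2) / 2) := by omega
        have : n * k + n ≤ 2 * ((k + 2) / 2 * n) := by
          calc n * k + n = (k + 1) * n := by ring
            _ ≤ 2 * ((k + 2) / 2) * n := Nat.mul_le_mul_right n this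
            _ = _ := by ring
        omega
      omega)
    omega
  · obtain ⟨g1, g2⟩ := smallElems_step_of_le (t := t) ha hb1 (by omega) hb (by omega) k
    rw [if_neg hab, if_neg hab, g2]
    obtain ⟨h1, h2⟩ := ih _ (by rw [if_neg hr]; omega) _ ((b - n % b) % b) b
      ((a + b * k) / n) g1 hc (by omega) rfl
    refine ⟨h1, ?_⟩
    have := hclog ((a + b * k) / n) (by
      have : (a + b * k) / n < (k + 2) / 2 + 1 := by
        rw [Nat.div_lt_iff_lt_mul (by omega)]
        have : k + 2 ≤ 2 * ((k + 2) / 2 + 1) := by omega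
        have : n * k + 2 * n ≤ 2 * (((k + 2) / 2 + 1) * n) := by
          calc n * k + 2 * n = (k + 2) * n := by ring
            _ ≤ 2 * ((k + 2) / 2 + 1) * n := Nat.mul_le_mul_right n this
            _ = _ := by ring
        omega
      omega)
    omega

/-! ### Correctness and running time for a fixed seed -/

theorem horner_ofFn {p : ℕ} (x : ZMod p) : ∀ {n : ℕ} (c : Fin n → ZMod p),
    (horner x (List.ofFn c)).val = ∑ l : Fin n, c l * x ^ (l : ℕ) ∧
      (horner x (List.ofFn c)).time = 3 * n
  | 0, c => by simp [horner]
  | n + 1, c => by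
    obtain ⟨h1, h2⟩ := horner_ofFn x fun l : Fin n => c l.succ
    rw [List.ofFn_succ]
    simp only [horner, Timed.val_bind, Timed.val_pure, Timed.time_bind, Timed.time_pure, tick_time,
      h1, h2, Fin.sum_univ_succ, Fin.val_succ, Finset.mul_sum]
    refine ⟨?_, by ring⟩
    simp only [Fin.val_zero, pow_zero, mul_one, pow_succ]
    congr 1
    exact Finset.sum_congr rfl fun l _ => by ring

theorem horner_polyVal {p d : ℕ} (x : ZMod p) (c : Fin (d + 1) → ZMod p) :
    (horner x (List.ofFn c)).val = polyVal c x ∧ (horner x (List.ofFn c)).time = 3 * (d + 1) :=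
  horner_ofFn x c

/-- The hashes of an item in the rows `0, 1, …` form an arithmetic progression modulo `p`. -/
theorem hashVal_eq {p d : ℕ} [NeZero p] (ω : Seed p d) (i x : ℕ) :
    hashVal ω i x =
      ((polyVal ω.1 (x : ZMod p)).val + i * (polyVal ω.2 (x : ZMod p)).val) % p := by
  rw [hashVal, ZMod.val_add, ZMod.val_mul, ZMod.val_natCast]
  simp [Nat.add_mod, Nat.mul_mod]

/-- The number of rows `i < k` in which the hash of `x` is smaller than `T`. -/
def smallCount {p d : ℕ} (ω : Seed p d) (k T x : ℕ) : ℕ :=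
  ((Finset.range k).filter fun i => hashVal ω i x < T).card

theorem smallElems_hash {p d : ℕ} [NeZero p] (ω : Seed p d) (k T x : ℕ) :
    smallElems (polyVal ω.1 (x : ZMod p)).val (polyVal ω.2 (x : ZMod p)).val p T 0 k =
      ((List.range k).map fun i => hashVal ω i x).filter (· < T) := by
  simp only [smallElems, List.Ico.zero_bot, hashVal_eq]

theorem length_smallElems_hash {p d : ℕ} [NeZero p] (ω : Seed p d) (k T x : ℕ) :
    (smallElems (polyVal ω.1 (x : ZMod p)).val (polyVal ω.2 (x : ZMod p)).val p T 0 k).length =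
      smallCount ω k T x := by
  rw [smallElems_hash, smallCount, List.filter_map, List.length_map]
  simp only [Finset.card, Finset.filter_val, Finset.range_val, Multiset.range, Multiset.filter_coe,
    Multiset.coe_card, Function.comp_def]

theorem prSmallVal_spec {p d : ℕ} [NeZero p] (ω : Seed p d) (k x T : ℕ) (hT : T ≤ p) :
    (prSmallVal ω k x T).val.Perm (((List.range k).map fun i => hashVal ω i x).filter (· < T)) ∧
    (prSmallVal ω k x T).val.length = smallCount ω k T x ∧
    (prSmallVal ω k x T).time ≤
      6 * (d + 1) + 28 * Nat.clog 2 k + 18 + 14 * smallCount ω k T x := by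
  obtain ⟨h1, h2⟩ := psMin_spec (polyVal ω.1 (x : ZMod p)).val (polyVal ω.2 (x : ZMod p)).val p k T
    (ZMod.val_lt _) (ZMod.val_lt _) hT
  rw [length_smallElems_hash] at h2
  have h3 := h1.length_eq
  rw [length_smallElems_hash] at h3
  rw [smallElems_hash] at h1
  have e1 := horner_polyVal (x : ZMod p) ω.1
  have e2 := horner_polyVal (x : ZMod p) ω.2
  simp only [prSmallVal, Timed.val_bind, Timed.time_bind, e1, e2]
  refine ⟨h1, h3, ?_⟩
  split_ifs at h2 <;> omega

/-- The pairs of an index and a value that are passed on to `updateRows`. -/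
theorem mem_zip_prSmall {p d : ℕ} [Fact p.Prime] (ω : Seed p d) (k x T : ℕ) (hT : T ≤ p)
    (hk : k ≤ p) (i v : ℕ) :
    (i, v) ∈ (prSmallLoc ω k x T).val.zip (prSmallVal ω k x T).val ↔
      i < k ∧ v = hashVal ω i x ∧ v < T := by
  obtain ⟨h1, -, -⟩ := prSmallVal_spec ω k x T hT
  set V := (prSmallVal ω k x T).val with hV
  have e1 := (horner_polyVal (x : ZMod p) ω.1).1
  have e2 := (horner_polyVal (x : ZMod p) ω.2).1
  have hV' : V = (psMin (polyVal ω.1 (x : ZMod p)).val (polyVal ω.2 (x : ZMod p)).val p k T).val := by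
    simp only [hV, prSmallVal, Timed.val_bind, e1, e2]
  have hI : (prSmallLoc ω k x T).val = if polyVal ω.2 (x : ZMod p) = 0 then List.range V.length
      else V.map fun v : ℕ => (((v : ZMod p) - polyVal ω.1 (x : ZMod p)) *
        (polyVal ω.2 (x : ZMod p))⁻¹).val := by
    simp only [prSmallLoc, Timed.val_bind, e1, e2, ← hV']
    split_ifs
    · rfl
    · simp [← List.map_eq_flatMap, Function.comp_def]
  rw [hI]
  have hmem : ∀ v, v ∈ V ↔ (∃ i < k, hashVal ω i x = v) ∧ v < T := fun v => by
    rw [h1.mem_iff]; simp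
  split_ifs with hb
  · have hc : ∀ i, hashVal ω i x = (polyVal ω.1 (x : ZMod p)).val := fun i => by
      rw [hashVal, hb, mul_zero, add_zero]
    simp only [hc] at h1 ⊢
    rw [List.map_const', List.length_range, List.filter_replicate] at h1
    by_cases ha : (polyVal ω.1 (x : ZMod p)).val < T
    · rw [if_pos (by simpa using ha), List.perm_replicate] at h1
      rw [h1, List.length_replicate]
      generalize (polyVal ω.1 (x : ZMod p)).val = a at *
      rw [List.mem_iff_getElem]
      simp only [List.getElem_zip, List.getElem_range, List.getElem_replicate, Prod.mk.injEq,
        List.length_zip, List.length_range, List.length_replicate, min_self]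
      constructor
      · rintro ⟨j, hj, rfl, rfl⟩; exact ⟨hj, rfl, ha⟩
      · rintro ⟨hj, rfl, -⟩; exact ⟨i, hj, rfl, rfl⟩
    · rw [if_neg (by simpa using ha), List.perm_nil] at h1
      rw [h1]
      simp only [List.zip_nil_right, List.not_mem_nil, false_iff]
      rintro ⟨-, rfl, h⟩
      exact ha h
  · have hz : ∀ g : ℕ → ℕ, (V.map g).zip V = V.map fun v => (g v, v) := fun g => by
      conv_lhs => rw [← List.map_id V, List.map_map]
      rw [List.zip_map']; rfl
    rw [hz, List.mem_map]
    -- Solving for the index recovers `j` itself, because `j < k ≤ p`.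
    have key : ∀ j < k, (((hashVal ω j x : ZMod p) - polyVal ω.1 (x : ZMod p)) *
        (polyVal ω.2 (x : ZMod p))⁻¹).val = j := fun j hj => by
      rw [hashVal, ZMod.natCast_zmod_val, add_sub_cancel_left, mul_assoc, mul_inv_cancel₀ hb,
        mul_one, ZMod.val_natCast, Nat.mod_eq_of_lt (by omega)]
    constructor
    · rintro ⟨w, hw, e⟩
      obtain ⟨⟨j, hj, rfl⟩, hwT⟩ := (hmem w).1 hw
      rw [key j hj, Prod.mk.injEq] at e
      obtain ⟨rfl, rfl⟩ := e
      exact ⟨hj, rfl, hwT⟩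
    · rintro ⟨hi, rfl, hT'⟩
      exact ⟨_, (hmem _).2 ⟨⟨i, hi, rfl⟩, hT'⟩, by rw [key i hi]⟩

theorem prSmallLoc_time {p d : ℕ} [NeZero p] (ω : Seed p d) (k x T : ℕ) (hT : T ≤ p) :
    (prSmallLoc ω k x T).time ≤
      6 * (d + 1) + 28 * Nat.clog 2 k + 20 + 18 * smallCount ω k T x := by
  obtain ⟨-, h2, h3⟩ := prSmallVal_spec ω k x T hT
  simp only [prSmallVal, Timed.val_bind, Timed.time_bind] at h2 h3
  simp only [prSmallLoc, Timed.time_bind, h2, tick_time]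
  split_ifs <;> simp only [Timed.time_bind, tick_time, Timed.time_pure] <;> omega

/-- Given pairs of a row and the hash `H` in this row, each listed row is lowered to its hash if
that is smaller, and all other rows stay unchanged.  Repetitions in the list are harmless. -/
theorem updateRows_spec (x : ℕ) (H : ℕ → ℕ) : ∀ (L : List (ℕ × ℕ)) (s : BlockState),
    (∀ y ∈ L, y.2 = H y.1) →
    (∀ i, ((updateRows x L s).val.minVal i =
        if (i, H i) ∈ L ∧ (H i : ℕ∞) < s.minVal i then (H i : ℕ∞) else s.minVal i) ∧
      (updateRows x L s).val.argMin i = if (i, H i) ∈ L ∧ (H i : ℕ∞) < s.minVal i then x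
        else s.argMin i) ∧
    (updateRows x L s).time ≤ 1 + 7 * L.length
  | [], s, _ => by simp [updateRows]
  | y :: L, s, h => by
    have hy : y.2 = H y.1 := h y (by simp)
    have hL : ∀ z ∈ L, z.2 = H z.1 := fun z hz => h z (by simp [hz])
    by_cases hc : (y.2 : ℕ∞) < s.minVal y.1
    · obtain ⟨h1, h2⟩ := updateRows_spec x H L
        ⟨Function.update s.minVal y.1 y.2, Function.update s.argMin y.1 x⟩ hL
      simp only [updateRows, Timed.val_bind, Timed.time_bind, hc, if_true, tick_time,
        List.length_cons]
      refine ⟨fun i => ?_, by omega⟩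
      rw [(h1 i).1, (h1 i).2]
      by_cases hi : i = y.1
      · subst hi
        have e : (y.1, H y.1) = y := by rw [← hy]
        rw [e]
        rw [hy] at hc
        simp [hy, hc]
      · have e : (i, H i) ∈ y :: L ↔ (i, H i) ∈ L := by
          rw [List.mem_cons, or_iff_right]
          rintro rfl
          exact hi rfl
        simp [Function.update_of_ne hi, e]
    · obtain ⟨h1, h2⟩ := updateRows_spec x H L s hL
      simp only [updateRows, Timed.val_bind, Timed.time_bind, hc, if_false, tick_time,
        List.length_cons]
      refine ⟨fun i => ?_, by omega⟩
      rw [(h1 i).1, (h1 i).2]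
      have e : ((i, H i) ∈ y :: L ∧ (H i : ℕ∞) < s.minVal i) ↔
          ((i, H i) ∈ L ∧ (H i : ℕ∞) < s.minVal i) := by
        rw [List.mem_cons, or_and_right, or_iff_right]
        rintro ⟨rfl, h'⟩
        exact hc h'
      exact ⟨by simp only [e], by simp only [e]⟩

/-- The state after the items in `xs`: a row in which no hash is smaller than `T` is untouched, and
every other row holds a minimizing item and the minimum. -/
def RowInvariant {p d : ℕ} (ω : Seed p d) (k T : ℕ) (xs : List ℕ) (s : BlockState) : Prop :=
  ∀ i < k, (s.minVal i = ⊤ ∧ ∀ x ∈ xs, T ≤ hashVal ω i x) ∨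
    (s.argMin i ∈ xs ∧ s.minVal i = (hashVal ω i (s.argMin i) : ℕ∞) ∧
      hashVal ω i (s.argMin i) < T ∧ ∀ x ∈ xs, hashVal ω i (s.argMin i) ≤ hashVal ω i x)

theorem processItems_invariant {p d : ℕ} [Fact p.Prime] (ω : Seed p d) (k T : ℕ) (hT : T ≤ p)
    (hk : k ≤ p) : ∀ (xs ys : List ℕ) (s : BlockState), RowInvariant ω k T ys s →
      RowInvariant ω k T (ys ++ xs) (processItems ω k T xs s).val
  | [], ys, s, h => by simpa [processItems] using h
  | x :: xs, ys, s, h => by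
    simp only [processItems, Timed.val_bind]
    rw [show ys ++ x :: xs = (ys ++ [x]) ++ xs by simp]
    refine processItems_invariant ω k T hT hk xs (ys ++ [x]) _ fun i hi => ?_
    have hz := mem_zip_prSmall ω k x T hT hk
    obtain ⟨h1, -⟩ := updateRows_spec x (fun i => hashVal ω i x)
      ((prSmallLoc ω k x T).val.zip (prSmallVal ω k x T).val) s
      fun y hy => ((hz y.1 y.2).1 hy).2.1
    obtain ⟨e1, e2⟩ := h1 i
    simp only [hz] at e1 e2
    rw [e1, e2]
    simp only [List.mem_append, List.mem_singleton, or_imp, forall_and, forall_eq]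
    by_cases hlt : hashVal ω i x < T
    · rcases h i hi with ⟨g1, g2⟩ | ⟨g1, g2, g3, g4⟩
      · rw [g1]
        simp only [hi, hlt, ENat.natCast_lt_top, and_self, if_true, true_and]
        exact Or.inr ⟨by simp, fun y hy => hlt.le.trans (g2 y hy), le_rfl⟩
      · rw [g2]
        by_cases hm : hashVal ω i x < hashVal ω i (s.argMin i)
        · simp only [hi, hlt, Nat.cast_lt, hm, and_self, if_true, true_and]
          exact Or.inr ⟨by simp, fun y hy => hm.le.trans (g4 y hy), le_rfl⟩
        · simp only [Nat.cast_lt, hm, and_false, if_false, true_and]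
          exact Or.inr ⟨Or.inl g1, g3, g4, not_lt.1 hm⟩
    · simp only [hlt, and_false, false_and, if_false]
      rcases h i hi with ⟨g1, g2⟩ | ⟨g1, g2, g3, g4⟩
      · exact Or.inl ⟨g1, g2, not_lt.1 hlt⟩
      · exact Or.inr ⟨Or.inl g1, g2, g3, g4, g3.le.trans (not_lt.1 hlt)⟩

/-- Hashes that are not smaller than the threshold are never seen by the algorithm; this does no
harm in a row that contains a smaller one. -/
theorem isBlockFingerprint_blockUpdate {p d : ℕ} [Fact p.Prime] (xs : List ℕ) (ω : Seed p d)
    (k : ℕ) (t : ℝ) (hk : k ≤ p)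
    (h : ∀ i < k, ∃ x ∈ xs, hashVal ω i x < intThreshold p t) :
    IsBlockFingerprint xs ω k (blockUpdate xs ω k t).val := by
  intro i hi
  have hinv := processItems_invariant ω k (intThreshold p t) (min_le_left _ _) hk xs []
    ⟨fun _ => ⊤, fun _ => 0⟩ (fun i _ => Or.inl ⟨rfl, by simp⟩) i hi
  simp only [blockUpdate, Timed.val_bind]
  rcases hinv with ⟨-, h2⟩ | ⟨h1, h2, -, h4⟩
  · obtain ⟨x, hx, hlt⟩ := h i hi
    exact absurd (h2 x (by simpa using hx)) (not_le.2 hlt)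
  · exact ⟨by simpa using h1, by simpa using h4, h2⟩

theorem processItems_time {p d : ℕ} [Fact p.Prime] (ω : Seed p d) (k T : ℕ) (hT : T ≤ p)
    (hk : k ≤ p) : ∀ (xs : List ℕ) (s : BlockState), (processItems ω k T xs s).time ≤
      1 + xs.length * (12 * (d + 1) + 56 * Nat.clog 2 k + 41) +
        39 * (xs.map (smallCount ω k T)).sum
  | [], s => by simp [processItems]
  | x :: xs, s => by
    obtain ⟨-, h2, h3⟩ := prSmallVal_spec ω k x T hT
    have h4 := prSmallLoc_time ω k x T hT
    obtain ⟨-, h5⟩ := updateRows_spec x (fun i => hashVal ω i x)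
      ((prSmallLoc ω k x T).val.zip (prSmallVal ω k x T).val) s
      fun y hy => ((mem_zip_prSmall ω k x T hT hk y.1 y.2).1 hy).2.1
    have h6 := processItems_time ω k T hT hk xs
      (updateRows x ((prSmallLoc ω k x T).val.zip (prSmallVal ω k x T).val) s).val
    simp only [processItems, Timed.time_bind, tick_time, List.map_cons, List.sum_cons,
      List.length_cons]
    rw [List.length_zip] at h5
    have h7 := min_le_right (prSmallLoc ω k x T).val.length (prSmallVal ω k x T).val.length
    rw [add_mul, one_mul]
    omega

theorem blockUpdate_time {p d : ℕ} [Fact p.Prime] (xs : List ℕ) (ω : Seed p d)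
    (k : ℕ) (t : ℝ) (hk : k ≤ p) : (blockUpdate xs ω k t).time ≤
      4 + 2 * k + xs.length * (12 * (d + 1) + 56 * Nat.clog 2 k + 41) +
        39 * (xs.map (smallCount ω k (intThreshold p t))).sum := by
  have := processItems_time ω k (intThreshold p t) (min_le_left _ _) hk xs
    ⟨fun _ => ⊤, fun _ => 0⟩
  simp only [blockUpdate, Timed.time_bind, tick_time]
  omega

/-! ### Uniform probability and expectation -/

theorem unifProb_eq_expect {Ω : Type} [Fintype Ω] [Nonempty Ω] (E : Set Ω) :
    unifProb E = Finset.univ.expect fun ω => E.indicator (fun _ => (1 : ℝ)) ω := by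
  classical
  rw [unifProb, PMF.toOuterMeasure_uniformOfFintype_apply, Fintype.expect_eq_sum_div_card,
    ENNReal.toReal_div, ENNReal.toReal_natCast, ENNReal.toReal_natCast]
  congr 1
  simp only [Set.indicator_apply]
  rw [Finset.sum_boole, Fintype.card_subtype]

theorem unifProb_le_add {Ω : Type} [Fintype Ω] [Nonempty Ω] {E A B : Set Ω} (h : E ⊆ A ∪ B) :
    unifProb E ≤ unifProb A + unifProb B := by
  classical
  simp only [unifProb_eq_expect, ← Finset.expect_add_distrib]
  refine Finset.expect_le_expect fun ω _ => ?_
  simp only [Set.indicator_apply]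
  by_cases hE : ω ∈ E
  · rcases h hE with h | h
    · rw [if_pos hE, if_pos h]; split_ifs <;> norm_num
    · rw [if_pos hE, if_pos h]; split_ifs <;> norm_num
  · rw [if_neg hE]; split_ifs <;> norm_num

theorem unifProb_mono {Ω : Type} [Fintype Ω] [Nonempty Ω] {E A : Set Ω} (h : E ⊆ A) :
    unifProb E ≤ unifProb A := by
  classical
  simp only [unifProb_eq_expect]
  exact Finset.expect_le_expect fun ω _ =>
    Set.indicator_le_indicator_of_subset h (fun _ => zero_le_one) ω

theorem unifProb_le_sum {Ω ι : Type} [Fintype Ω] [Nonempty Ω] {E : Set Ω} (s : Finset ι)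
    (A : ι → Set Ω) (h : ∀ ω ∈ E, ∃ i ∈ s, ω ∈ A i) :
    unifProb E ≤ ∑ i ∈ s, unifProb (A i) := by
  classical
  simp only [unifProb_eq_expect]
  rw [← Finset.expect_sum_comm]
  refine Finset.expect_le_expect fun ω _ => ?_
  have h0 : ∀ i, 0 ≤ (A i).indicator (fun _ => (1 : ℝ)) ω := fun i =>
    Set.indicator_nonneg (by simp) ω
  by_cases hE : ω ∈ E
  · obtain ⟨i, hi, hA⟩ := h ω hE
    rw [Set.indicator_of_mem hE]
    refine le_trans ?_ (Finset.single_le_sum (fun i _ => h0 i) hi)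
    rw [Set.indicator_of_mem hA]
  · rw [Set.indicator_of_notMem hE]
    exact Finset.sum_nonneg fun i _ => h0 i

/-- Markov's inequality. -/
theorem unifProb_mul_le_expect {Ω : Type} [Fintype Ω] [Nonempty Ω] {E : Set Ω} {X : Ω → ℝ}
    {c : ℝ} (hX : ∀ ω, 0 ≤ X ω) (hE : ∀ ω ∈ E, c ≤ X ω) :
    unifProb E * c ≤ Finset.univ.expect X := by
  classical
  rw [unifProb_eq_expect, Finset.expect_mul]
  refine Finset.expect_le_expect fun ω _ => ?_
  by_cases h : ω ∈ E
  · rw [Set.indicator_of_mem h, one_mul]; exact hE ω h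
  · rw [Set.indicator_of_notMem h, zero_mul]; exact hX ω

/-- A surjective homomorphism of finite groups maps the uniform distribution to the uniform
distribution. -/
theorem expect_comp_of_surjective {G H : Type} [AddGroup G] [AddGroup H] [Fintype G] [Fintype H]
    (f : G →+ H) (hf : Function.Surjective f) (F : H → ℝ) :
    (Finset.univ.expect fun g => F (f g)) = Finset.univ.expect F := by
  classical
  have hN : ∀ h, (Finset.univ.filter fun g => f g = h).card =
      (Finset.univ.filter fun g => f g = 0).card := fun h =>
    AddMonoidHom.card_fiber_eq_of_mem_range f (hf h) (hf 0)
  set N := (Finset.univ.filter fun g => f g = 0).card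
  have hs : ∀ F : H → ℝ, ∑ g, F (f g) = N * ∑ h, F h := fun F => by
    rw [← Finset.sum_fiberwise (s := Finset.univ) f, Finset.mul_sum]
    refine Finset.sum_congr rfl fun h _ => ?_
    rw [Finset.sum_congr rfl fun g hg => by rw [(Finset.mem_filter.1 hg).2], Finset.sum_const, hN,
      nsmul_eq_mul]
  have hc := hs fun _ => 1
  have h0 : (0 : ℝ) < Fintype.card G := by exact_mod_cast Fintype.card_pos
  simp only [Finset.sum_const, nsmul_eq_mul, mul_one, Finset.card_univ] at hc
  rw [Fintype.expect_eq_sum_div_card, Fintype.expect_eq_sum_div_card, hs, hc, mul_div_mul_left]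
  rintro h
  rw [hc, h, zero_mul] at h0
  exact lt_irrefl _ h0

/-- The coordinates of a uniformly random function are independent. -/
theorem expect_prod {ι V : Type} [Fintype ι] [DecidableEq ι] [Fintype V] (F : ι → V → ℝ) :
    (Finset.univ.expect fun w : ι → V => ∏ i, F i (w i)) = ∏ i, Finset.univ.expect (F i) := by
  simp only [Fintype.expect_eq_sum_div_card, Finset.prod_div_distrib, Finset.prod_univ_sum,
    Fintype.piFinset_univ, Finset.prod_const, Fintype.card_fun, Finset.card_univ, Nat.cast_pow]

/-- An event about one of finitely many independent uniform choices. -/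
theorem unifProb_eval {m : ℕ} {G : Type} [AddGroup G] [Fintype G] (r : Fin m) (E : Set G) :
    unifProb {ω : Fin m → G | ω r ∈ E} = unifProb E := by
  rw [unifProb_eq_expect, unifProb_eq_expect]
  exact expect_comp_of_surjective (Pi.evalAddMonoidHom (fun _ : Fin m => G) r)
    (Function.surjective_eval r) (E.indicator fun _ => (1 : ℝ))

/-! ### Independence of the hashes in a row -/

/-- The hash of row `i` as an element of `ZMod p`. -/
def rowVal {p d : ℕ} (ω : Seed p d) (i : ℕ) (z : ZMod p) : ZMod p :=
  polyVal ω.1 z + (i : ZMod p) * polyVal ω.2 z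

/-- Lagrange interpolation in at most `d + 1` points by a polynomial of degree at most `d`. -/
theorem exists_polyVal_eq {p d : ℕ} [Fact p.Prime] (S : Finset (ZMod p)) (hS : S.card ≤ d + 1)
    (w : S → ZMod p) : ∃ c : Fin (d + 1) → ZMod p, ∀ z : S, polyVal c (z : ZMod p) = w z := by
  classical
  have hinj : Set.InjOn (fun z : S => (z : ZMod p)) (Finset.univ : Finset S) :=
    Subtype.val_injective.injOn
  set P := Lagrange.interpolate (Finset.univ : Finset S) (fun z => (z : ZMod p)) w with hP
  have hdeg : P.natDegree < d + 1 := by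
    have := Lagrange.degree_interpolate_lt w hinj
    rw [← hP] at this
    have h2 : P.degree < ((d + 1 : ℕ) : WithBot ℕ) := this.trans_le (by
      rw [Finset.card_univ, Fintype.card_coe]; exact_mod_cast hS)
    rcases eq_or_ne P 0 with h | h
    · simp [h]
    · exact (Polynomial.natDegree_lt_iff_degree_lt h).2 h2
  refine ⟨fun l => P.coeff l, fun z => ?_⟩
  rw [← Lagrange.eval_interpolate_at_node w hinj (Finset.mem_univ z), ← hP,
    Polynomial.eval_eq_sum_range' hdeg, polyVal, Finset.sum_range]

/-- The hashes of at most `d + 1` distinct points in one row are independent and uniform. -/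
theorem expect_prod_rowVal {p d : ℕ} [Fact p.Prime] (i : ℕ) (S : Finset (ZMod p))
    (hS : S.card ≤ d + 1) (F : ZMod p → ZMod p → ℝ) :
    (Finset.univ.expect fun ω : Seed p d => ∏ z ∈ S, F z (rowVal ω i z)) =
      ∏ z ∈ S, Finset.univ.expect (F z) := by
  classical
  let f : Seed p d →+ (S → ZMod p) :=
    { toFun := fun ω z => rowVal ω i z
      map_zero' := by ext z; simp [rowVal, polyVal]
      map_add' := fun ω ω' => by
        ext z
        simp only [rowVal, polyVal, Prod.fst_add, Prod.snd_add, Pi.add_apply, add_mul,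
          Finset.sum_add_distrib]
        ring }
  have hf : Function.Surjective f := fun w => by
    obtain ⟨c, hc⟩ := exists_polyVal_eq S hS w
    refine ⟨(c, 0), ?_⟩
    ext z
    change rowVal (c, 0) i z = w z
    rw [← hc z]
    simp [rowVal, polyVal]
  rw [← Finset.prod_coe_sort S fun z => Finset.univ.expect (F z), ← expect_prod,
    ← expect_comp_of_surjective f hf]
  refine Finset.expect_congr rfl fun ω _ => ?_
  rw [← Finset.prod_coe_sort S]
  rfl

theorem expect_rowVal {p d : ℕ} [Fact p.Prime] (i : ℕ) (z : ZMod p) (F : ZMod p → ℝ) :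
    (Finset.univ.expect fun ω : Seed p d => F (rowVal ω i z)) = Finset.univ.expect F := by
  simpa using expect_prod_rowVal (d := d) i {z} (by simp) fun _ => F

theorem expect_val_lt {p T : ℕ} [NeZero p] (hT : T ≤ p) :
    (Finset.univ.expect fun v : ZMod p => if v.val < T then (1 : ℝ) else 0) = T / p := by
  rw [Fintype.expect_eq_sum_div_card, Finset.sum_boole, ZMod.card]
  congr 2
  refine (Finset.card_nbij' (t := Finset.range T) ZMod.val (fun n : ℕ => (n : ZMod p))
    ?_ ?_ ?_ ?_).trans (Finset.card_range T)
  · intro v hv; simpa using hv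
  · intro n hn
    have hn : n < T := by simpa using hn
    simp [ZMod.val_natCast, Nat.mod_eq_of_lt (hn.trans_le hT), hn]
  · intro v _; simp
  · intro n hn
    have hn : n < T := by simpa using hn
    simp [ZMod.val_natCast, Nat.mod_eq_of_lt (hn.trans_le hT)]

/-! ### The probability that a row has no small hash -/

/-- The centred indicator of the values smaller than `T`. -/
noncomputable def centredSmall (p T : ℕ) (v : ZMod p) : ℝ :=
  (if v.val < T then 1 else 0) - (T : ℝ) / p

theorem expect_centredSmall {p T : ℕ} [NeZero p] (hT : T ≤ p) :
    Finset.univ.expect (centredSmall p T) = 0 := by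
  unfold centredSmall
  rw [Finset.expect_sub_distrib, expect_val_lt hT, Finset.expect_const Finset.univ_nonempty,
    sub_self]

theorem expect_centredSmall_sq_le {p T : ℕ} [NeZero p] (hT : T ≤ p) :
    (Finset.univ.expect fun v => centredSmall p T v ^ 2) ≤ (T : ℝ) / p := by
  have e : ∀ v : ZMod p, centredSmall p T v ^ 2 =
      (1 - 2 * ((T : ℝ) / p)) * (if v.val < T then (1 : ℝ) else 0) + ((T : ℝ) / p) ^ 2 := fun v => by
    rw [centredSmall]; split_ifs <;> ring
  simp only [e]
  rw [Finset.expect_add_distrib, ← Finset.mul_expect, expect_val_lt hT,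
    Finset.expect_const Finset.univ_nonempty]
  nlinarith [sq_nonneg ((T : ℝ) / p)]

/-- The product over `r` disjoint groups of the squared deviations of the number of small hashes has
degree `2 * r` in the hashes, so by `(d + 1)`-wise independence its mean is the product of the `r`
variances, each of which is at most `s * (T / p)`. -/
theorem expect_prod_centredSmall_le {p d T r s : ℕ} [Fact p.Prime] (i : ℕ) (hT : T ≤ p)
    (hr : 2 * r ≤ d + 1) (e : Fin r × Fin s → ZMod p) (he : Function.Injective e) :
    (Finset.univ.expect fun ω : Seed p d =>
      ∏ j, (∑ l, centredSmall p T (rowVal ω i (e (j, l)))) ^ 2) ≤ (s * ((T : ℝ) / p)) ^ r := by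
  classical
  have hexp : ∀ ω : Seed p d, ∏ j, (∑ l, centredSmall p T (rowVal ω i (e (j, l)))) ^ 2 =
      ∑ c : Fin r × Bool → Fin s, ∏ a, centredSmall p T (rowVal ω i (e (a.1, c a))) := fun ω => by
    rw [← Fintype.piFinset_univ, ← Finset.prod_univ_sum (fun _ => Finset.univ)
      (fun (a : Fin r × Bool) l => centredSmall p T (rowVal ω i (e (a.1, l)))),
      Fintype.prod_prod_type]
    simp only [Fintype.prod_bool, sq]
  simp only [hexp]
  rw [Finset.expect_sum_comm]
  have hq : (0 : ℝ) ≤ (T : ℝ) / p := by positivity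
  have hterm : ∀ c : Fin r × Bool → Fin s,
      (Finset.univ.expect fun ω : Seed p d =>
        ∏ a, centredSmall p T (rowVal ω i (e (a.1, c a)))) ≤
      if ∀ j, c (j, true) = c (j, false) then ((T : ℝ) / p) ^ r else 0 := fun c => by
    split_ifs with hc
    · have hinj : Function.Injective fun j => e (j, c (j, true)) := fun j j' h =>
        (Prod.mk.inj (he h)).1
      -- The two choices agree in every group: a product of squares at distinct points.
      have e1 : ∀ ω : Seed p d, ∏ a, centredSmall p T (rowVal ω i (e (a.1, c a))) =
          ∏ z ∈ Finset.univ.image fun j => e (j, c (j, true)),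
            (fun v => centredSmall p T v ^ 2) (rowVal ω i z) := fun ω => by
        rw [Finset.prod_image hinj.injOn, Fintype.prod_prod_type]
        simp only [Fintype.prod_bool, sq, ← hc]
      simp only [e1]
      have hcard := Finset.card_image_of_injective Finset.univ hinj
      rw [Finset.card_univ, Fintype.card_fin] at hcard
      rw [expect_prod_rowVal i _ (by omega) fun _ v => centredSmall p T v ^ 2, Finset.prod_const,
        hcard]
      exact pow_le_pow_left₀ (Finset.expect_nonneg fun v _ => sq_nonneg _)
        (expect_centredSmall_sq_le hT) r
    · obtain ⟨j, hj⟩ := not_forall.1 hc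
      -- In some group `j` the two choices differ, so the point chosen first occurs with exponent `1`,
      -- and its factor has mean `0`.
      have e1 := fun ω : Seed p d => Finset.prod_comp (s := Finset.univ)
        (fun z => centredSmall p T (rowVal ω i z)) fun a : Fin r × Bool => e (a.1, c a)
      simp only [e1]
      have hcard : (Finset.univ.image fun a : Fin r × Bool => e (a.1, c a)).card ≤ d + 1 :=
        Finset.card_image_le.trans (by simp; omega)
      rw [expect_prod_rowVal i _ hcard fun z v => centredSmall p T v ^
        (Finset.univ.filter fun a : Fin r × Bool => e (a.1, c a) = z).card]
      refine (Finset.prod_eq_zero (Finset.mem_image_of_mem _ (Finset.mem_univ (j, true))) ?_).le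
      have h1 : (Finset.univ.filter fun a : Fin r × Bool =>
          e (a.1, c a) = e ((j, true).1, c (j, true))) = {(j, true)} := by
        ext ⟨j', b⟩
        simp only [Finset.mem_filter, Finset.mem_univ, true_and, Finset.mem_singleton,
          he.eq_iff, Prod.mk.injEq]
        constructor
        · rintro ⟨rfl, h⟩
          cases b
          · exact absurd h.symm hj
          · exact ⟨rfl, rfl⟩
        · rintro ⟨rfl, rfl⟩; exact ⟨rfl, rfl⟩
      rw [h1, Finset.card_singleton]
      simpa using expect_centredSmall hT
  refine (Finset.sum_le_sum fun c _ => hterm c).trans ?_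
  rw [← Finset.sum_filter, Finset.sum_const, nsmul_eq_mul, mul_pow]
  refine mul_le_mul_of_nonneg_right ?_ (pow_nonneg hq r)
  -- Pairs of choices that agree in every group are determined by the first choices.
  have hcard : (Finset.univ.filter fun c : Fin r × Bool → Fin s =>
      ∀ j, c (j, true) = c (j, false)).card ≤ (Finset.univ : Finset (Fin r → Fin s)).card := by
    refine Finset.card_le_card_of_injOn (fun c j => c (j, true)) (by simp) fun c hc c' hc' h => ?_
    simp only [Finset.coe_filter, Finset.mem_univ, true_and, Set.mem_ofPred_eq] at hc hc'
    ext ⟨j, b⟩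
    have := congrFun h j
    cases b
    · rw [← hc, ← hc']; exact congrArg _ this
    · exact congrArg _ this
  simpa using (Nat.cast_le (α := ℝ)).2 hcard

/-- The items are split into `r` groups of size `s`.  If no hash is smaller than `T`, then in each
group the number of small hashes deviates from its mean `s * (T / p)` by this mean. -/
theorem unifProb_forall_le_rowVal {p d T r s : ℕ} [Fact p.Prime] (i : ℕ) (hT : T ≤ p)
    (hr : 2 * r ≤ d + 1) (e : Fin r × Fin s → ZMod p) (he : Function.Injective e)
    (hpos : 0 < s * ((T : ℝ) / p)) :
    unifProb {ω : Seed p d | ∀ a, T ≤ (rowVal ω i (e a)).val} ≤ ((s * ((T : ℝ) / p)) ^ r)⁻¹ := by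
  have h := (unifProb_mul_le_expect (E := {ω : Seed p d | ∀ a, T ≤ (rowVal ω i (e a)).val})
    (X := fun ω => ∏ j, (∑ l, centredSmall p T (rowVal ω i (e (j, l)))) ^ 2)
    (c := (s * ((T : ℝ) / p)) ^ r * (s * ((T : ℝ) / p)) ^ r)
    (fun ω => Finset.prod_nonneg fun j _ => sq_nonneg _) fun ω hω => by
      have : ∀ a, centredSmall p T (rowVal ω i (e a)) = - ((T : ℝ) / p) := fun a => by
        rw [centredSmall, if_neg (not_lt.2 (hω a)), zero_sub]
      simp only [this, Finset.sum_const, Finset.prod_const, Finset.card_univ, Fintype.card_fin,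
        nsmul_eq_mul]
      refine le_of_eq ?_
      ring).trans (expect_prod_centredSmall_le i hT hr e he)
  have hp := pow_pos hpos r
  rw [← mul_assoc] at h
  rw [← one_div, le_div_iff₀ hp]
  exact (mul_le_iff_le_one_left hp).1 h

/-! ### The expected number of small hashes -/

theorem expect_smallCount {p d : ℕ} [Fact p.Prime] (k T x : ℕ) (hT : T ≤ p) :
    (Finset.univ.expect fun ω : Seed p d => (smallCount ω k T x : ℝ)) = k * ((T : ℝ) / p) := by
  have e : ∀ ω : Seed p d, (smallCount ω k T x : ℝ) = ∑ i ∈ Finset.range k,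
      (fun v : ZMod p => if v.val < T then (1 : ℝ) else 0) (rowVal ω i x) := fun ω => by
    rw [smallCount, ← Finset.sum_boole]; rfl
  simp only [e]
  rw [Finset.expect_sum_comm]
  refine (Finset.sum_congr rfl fun i _ =>
    (expect_rowVal i (x : ZMod p) _).trans (expect_val_lt hT)).trans ?_
  rw [Finset.sum_const, Finset.card_range, nsmul_eq_mul]

/-! ### Parameters and the failure probabilities -/

theorem logb_one_div_pos {x : ℝ} (h0 : 0 < x) (h1 : x < 1) : 0 < Real.logb 2 (1 / x) :=
  Real.logb_pos one_lt_two (one_lt_one_div h0 h1)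

theorem one_le_mul_logb_one_div {x x₀ : ℝ} (h0 : 0 < x) (hx : x ≤ x₀) (h1 : x₀ < 1) :
    1 ≤ |1 / Real.logb 2 (1 / x₀)| * Real.logb 2 (1 / x) := by
  have hpos := logb_one_div_pos (h0.trans_le hx) h1
  have hle : Real.logb 2 (1 / x₀) ≤ Real.logb 2 (1 / x) :=
    Real.logb_le_logb_of_le one_lt_two (by have := h0.trans_le hx; positivity)
      (one_div_le_one_div_of_le h0 hx)
  rw [abs_of_pos (by positivity), one_div, ← div_eq_inv_mul, le_div_iff₀ hpos, one_mul]
  exact hle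

theorem rpow_logb_one_div {ε : ℝ} (h0 : 0 < ε) : (2 : ℝ) ^ Real.logb 2 (1 / ε) = 1 / ε :=
  Real.rpow_logb two_pos (by norm_num) (by positivity)

theorem numHashes_le {ε : ℝ} (h0 : 0 < ε) (h1 : ε < 1) : (numHashes ε : ℝ) ≤ 10 * (1 / ε ^ 2) := by
  have hε : 1 ≤ 1 / ε ^ 2 := by
    rw [le_div_iff₀ (by positivity)]; nlinarith
  have := (Nat.ceil_lt_add_one (a := 8.02 / ε ^ 2) (by positivity)).le
  rw [numHashes]
  have e : 8.02 / ε ^ 2 = 8.02 * (1 / ε ^ 2) := by ring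
  rw [e] at this ⊢
  linarith

theorem clog_numHashes_le {ε : ℝ} (h0 : 0 < ε) (h1 : ε < 1) :
    (Nat.clog 2 (numHashes ε) : ℝ) ≤ 5 + 2 * Real.logb 2 (1 / ε) := by
  have hL := logb_one_div_pos h0 h1
  set L := Real.logb 2 (1 / ε) with hLdef
  have hm := Nat.ceil_lt_add_one (a := 4 + 2 * L) (by positivity)
  have hk : numHashes ε ≤ 2 ^ ⌈4 + 2 * L⌉₊ := by
    have h2 : (2 : ℝ) ^ (4 + 2 * L) ≤ 2 ^ (⌈4 + 2 * L⌉₊ : ℝ) :=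
      Real.rpow_le_rpow_of_exponent_le one_le_two (Nat.le_ceil _)
    rw [Real.rpow_natCast, Real.rpow_add two_pos, mul_comm 2 L, Real.rpow_mul two_pos.le, hLdef,
      rpow_logb_one_div h0, ← hLdef] at h2
    have h3 := numHashes_le h0 h1
    have h4 : (1 / ε) ^ (2 : ℝ) = 1 / ε ^ 2 := by
      rw [Real.rpow_two, div_pow, one_pow]
    have h5 : (2 : ℝ) ^ (4 : ℝ) = 16 := by
      rw [show (4 : ℝ) = (4 : ℕ) by norm_num, Real.rpow_natCast]; norm_num
    rw [h4, h5, mul_comm L 2] at h2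
    have h6 : 0 < 1 / ε ^ 2 := by positivity
    have : (numHashes ε : ℝ) ≤ ((2 ^ ⌈4 + 2 * L⌉₊ : ℕ) : ℝ) := by
      push_cast
      linarith
    exact_mod_cast this
  have : (Nat.clog 2 (numHashes ε) : ℝ) ≤ (⌈4 + 2 * L⌉₊ : ℝ) := by
    exact_mod_cast Nat.clog_le_of_le_pow hk
  linarith

theorem length_le_of_nodup {xs : List ℕ} {p : ℕ} (hn : xs.Nodup) (hx : ∀ x ∈ xs, x < p) :
    xs.length ≤ p := by
  rw [← List.toFinset_card_of_nodup hn, ← Finset.card_range p]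
  exact Finset.card_le_card fun x h => Finset.mem_range.2 (hx x (List.mem_toFinset.1 h))

/-- The probability that all hashes of a row exceed the threshold.  About `ℓ' / 2` groups are used,
each with at least `16` small hashes in the mean. -/
theorem unifProb_row_le {ε : ℝ} {p d : ℕ} [Fact p.Prime] {xs : List ℕ} (h0 : 0 < ε) (h1 : ε < 1)
    (hd : ellPrime ε < d) (hne : xs ≠ []) (hn : xs.Nodup) (hx : ∀ x ∈ xs, x < p) (i : ℕ) :
    unifProb {ω : Seed p d | ∀ x ∈ xs,
      intThreshold p (threshold p xs.length ε) ≤ hashVal ω i x} ≤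
      ((16 : ℝ) ^ ⌊ellPrime ε / 2⌋₊)⁻¹ := by
  have hL := logb_one_div_pos h0 h1
  have hl : 80 < ellPrime ε := by rw [ellPrime]; linarith
  have hb : 0 < xs.length := List.length_pos_iff.2 hne
  have hp : 0 < p := (Fact.out : p.Prime).pos
  set l := ellPrime ε
  set t := threshold p xs.length ε with ht
  set T := intThreshold p t with hTdef
  have hTp : T ≤ p := min_le_left _ _
  rcases hTp.lt_or_eq with hlt | heq
  · have hT : T = ⌊t⌋₊ + 1 := by
      rw [hTdef, intThreshold] at hlt ⊢
      omega
    have htT : t < T := by rw [hT]; exact_mod_cast Nat.lt_floor_add_one t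
    have hpR : (0 : ℝ) < p := by exact_mod_cast hp
    have hbR : (0 : ℝ) < xs.length := by exact_mod_cast hb
    -- A threshold below `p` means that there are many items, so rounding in `s` costs little.
    have hbl : 12 * l < xs.length := by
      have h2 : t < p := htT.trans (by exact_mod_cast hlt)
      rw [ht, threshold, div_lt_iff₀ hbR] at h2
      have h3 : p * (12 * l) < p * xs.length := by linarith
      exact lt_of_mul_lt_mul_left h3 hpR.le
    set r := ⌊l / 2⌋₊
    have hr1 : (r : ℝ) ≤ l / 2 := Nat.floor_le (by linarith)
    have hr2 : 1 ≤ r := Nat.le_floor (by push_cast; linarith)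
    set s := xs.length / r
    have hs1 : r * s ≤ xs.length := Nat.mul_div_le _ _
    have hs2 : (xs.length : ℝ) < r * s + r := by
      exact_mod_cast Nat.lt_mul_div_succ xs.length hr2
    have hq : 12 * l / xs.length ≤ (T : ℝ) / p := by
      rw [div_le_div_iff₀ hbR hpR]
      rw [ht, threshold, div_lt_iff₀ hbR] at htT
      linarith
    have h16 : 16 ≤ s * ((T : ℝ) / p) := by
      refine le_trans ?_ (mul_le_mul_of_nonneg_left hq (Nat.cast_nonneg s))
      rw [← mul_div_assoc, le_div_iff₀ hbR]
      have : (s : ℝ) * r ≤ s * (l / 2) := mul_le_mul_of_nonneg_left hr1 (Nat.cast_nonneg s)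
      linarith
    let e : Fin r × Fin s → ZMod p := fun a =>
      (xs.get (Fin.castLE hs1 (finProdFinEquiv a)) : ZMod p)
    have he : Function.Injective e := fun a a' h => by
      have h2 := congrArg ZMod.val h
      rw [ZMod.val_natCast_of_lt (hx _ (xs.get_mem _)),
        ZMod.val_natCast_of_lt (hx _ (xs.get_mem _))] at h2
      exact finProdFinEquiv.injective
        (Fin.castLE_injective hs1 (List.nodup_iff_injective_get.1 hn h2))
    have hrd : 2 * r ≤ d + 1 := by
      have : (2 * r : ℝ) ≤ d := by linarith
      have : 2 * r ≤ d := by exact_mod_cast this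
      omega
    calc unifProb {ω : Seed p d | ∀ x ∈ xs, T ≤ hashVal ω i x}
        ≤ unifProb {ω : Seed p d | ∀ a, T ≤ (rowVal ω i (e a)).val} :=
          unifProb_mono fun ω hω a => hω _ (xs.get_mem _)
      _ ≤ ((s * ((T : ℝ) / p)) ^ r)⁻¹ :=
          unifProb_forall_le_rowVal i hTp hrd e he (by linarith)
      _ ≤ ((16 : ℝ) ^ r)⁻¹ :=
          inv_anti₀ (by positivity) (pow_le_pow_left₀ (by norm_num) h16 r)
  · -- Every hash is smaller than `p`.
    have hE : {ω : Seed p d | ∀ x ∈ xs, T ≤ hashVal ω i x} = ∅ := by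
      refine Set.eq_empty_of_forall_notMem fun ω hω => ?_
      obtain ⟨x, hxs⟩ := List.exists_mem_of_ne_nil xs hne
      have := hω x hxs
      rw [heq] at this
      exact absurd (ZMod.val_lt _) (not_lt.2 this)
    rw [hE, unifProb_eq_expect]
    simp only [Set.indicator_empty]
    rw [Finset.expect_const_zero]
    positivity

/-- The union bound over the rows: `16 ^ ⌊ℓ' / 2⌋` is at least `2 ^ 156 / ε ^ 4`. -/
theorem numHashes_mul_lt {ε : ℝ} (h0 : 0 < ε) (h1 : ε < 1) :
    numHashes ε * ((16 : ℝ) ^ ⌊ellPrime ε / 2⌋₊)⁻¹ < 1 / 2 ^ 29 := by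
  have hr := Nat.lt_floor_add_one (ellPrime ε / 2)
  set r := ⌊ellPrime ε / 2⌋₊
  have hL : Real.logb 2 (1 / ε) * 4 + (156 : ℕ) ≤ ((4 * r : ℕ) : ℝ) := by
    rw [ellPrime] at hr
    push_cast
    linarith
  have h2 := Real.rpow_le_rpow_of_exponent_le one_le_two hL
  rw [Real.rpow_add two_pos, Real.rpow_mul two_pos.le, rpow_logb_one_div h0, Real.rpow_natCast,
    Real.rpow_natCast, show (4 : ℝ) = (4 : ℕ) by norm_num, Real.rpow_natCast, pow_mul] at h2
  have h3 : ((16 : ℝ) ^ r)⁻¹ ≤ ε ^ 4 / 2 ^ 156 := by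
    have : (16 : ℝ) ^ r = (2 ^ 4) ^ r := by norm_num
    rw [this, ← one_div, div_le_div_iff₀ (by positivity) (by positivity), one_mul]
    calc (2 : ℝ) ^ 156 = ε ^ 4 * ((1 / ε) ^ 4 * 2 ^ 156) := by field_simp
      _ ≤ _ := mul_le_mul_of_nonneg_left h2 (by positivity)
  have hε : ε ^ 2 ≤ 1 := by nlinarith
  calc numHashes ε * ((16 : ℝ) ^ r)⁻¹ ≤ (10 * (1 / ε ^ 2)) * (ε ^ 4 / 2 ^ 156) :=
        mul_le_mul (numHashes_le h0 h1) h3 (by positivity) (by positivity)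
    _ = 10 / 2 ^ 156 * ε ^ 2 := by field_simp
    _ ≤ 10 / 2 ^ 156 * 1 := mul_le_mul_of_nonneg_left hε (by positivity)
    _ < 1 / 2 ^ 29 := by norm_num

theorem unifProb_incorrect_lt {ε : ℝ} {p d : ℕ} [Fact p.Prime] {xs : List ℕ} (h0 : 0 < ε)
    (h1 : ε < 1) (hk : numHashes ε ≤ p) (hd : ellPrime ε < d) (hne : xs ≠ []) (hn : xs.Nodup)
    (hx : ∀ x ∈ xs, x < p) :
    unifProb {ω : Seed p d | ¬ IsBlockFingerprint xs ω (numHashes ε)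
      (blockUpdate xs ω (numHashes ε) (threshold p xs.length ε)).val} < 1 / 2 ^ 29 := by
  refine lt_of_le_of_lt ?_ (numHashes_mul_lt h0 h1)
  refine (unifProb_le_sum (Finset.range (numHashes ε)) (fun i => {ω : Seed p d | ∀ x ∈ xs,
    intThreshold p (threshold p xs.length ε) ≤ hashVal ω i x}) fun ω hω => ?_).trans ?_
  · by_contra hcon
    -- An incorrect fingerprint needs a row without a small hash.
    refine hω (isBlockFingerprint_blockUpdate xs ω _ _ hk fun i hi => ?_)
    by_contra hcon'
    push Not at hcon'
    exact hcon ⟨i, Finset.mem_range.2 hi, hcon'⟩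
  · refine (Finset.sum_le_sum fun i _ => unifProb_row_le h0 h1 hd hne hn hx i).trans ?_
    rw [Finset.sum_const, Finset.card_range, nsmul_eq_mul]

/-- The constant in the bound on the expected time. -/
noncomputable def meanConst (ε₀ D : ℝ) : ℝ :=
  12 * |D| + 400000 * |1 / Real.logb 2 (1 / ε₀)| + 10000

theorem meanConst_pos (ε₀ D : ℝ) : 0 < meanConst ε₀ D := by rw [meanConst]; positivity

theorem blockTime_pos {ε : ℝ} (h0 : 0 < ε) (h1 : ε < 1) (b : ℕ) : 0 < blockTime b ε := by
  have := logb_one_div_pos h0 h1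
  rw [blockTime]; positivity

/-- The expected running time.  The expected number of small hashes over all items and rows is
at most `k * (12 * ℓ' + 1)`; the summand `1` pays for the rounding of the threshold. -/
theorem expect_time_le {ε ε₀ D : ℝ} {p d : ℕ} [Fact p.Prime] {xs : List ℕ} (h0 : 0 < ε)
    (hε : ε ≤ ε₀) (h1 : ε₀ < 1) (hk : numHashes ε ≤ p) (hd : (d : ℝ) ≤ D * Real.logb 2 (1 / ε))
    (hne : xs ≠ []) (hn : xs.Nodup) (hx : ∀ x ∈ xs, x < p) :
    (Finset.univ.expect fun ω : Seed p d =>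
      ((blockUpdate xs ω (numHashes ε) (threshold p xs.length ε)).time : ℝ)) ≤
      meanConst ε₀ D * blockTime xs.length ε := by
  have h1' := hε.trans_lt h1
  have hL := logb_one_div_pos h0 h1'
  have hM := one_le_mul_logb_one_div h0 hε h1
  have hM0 := abs_nonneg (1 / Real.logb 2 (1 / ε₀))
  have hk' := numHashes_le h0 h1'
  have hc := clog_numHashes_le h0 h1'
  have hb : (1 : ℝ) ≤ xs.length := by exact_mod_cast List.length_pos_iff.2 hne
  have hbp : (xs.length : ℝ) ≤ p := by exact_mod_cast length_le_of_nodup hn hx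
  have hp : (0 : ℝ) < p := by linarith
  set T := intThreshold p (threshold p xs.length ε) with hT
  have hTp : T ≤ p := min_le_left _ _
  have hl : 0 < ellPrime ε := by rw [ellPrime]; linarith
  have hTt : xs.length * ((T : ℝ) / p) ≤ 12 * ellPrime ε + 1 := by
    have h2 : (T : ℝ) ≤ threshold p xs.length ε + 1 := by
      have h3 : T ≤ ⌊threshold p xs.length ε⌋₊ + 1 := min_le_right _ _
      have h4 := Nat.floor_le (a := threshold p xs.length ε) (by rw [threshold]; positivity)
      have h5 : (T : ℝ) ≤ (⌊threshold p xs.length ε⌋₊ : ℝ) + 1 := by exact_mod_cast h3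
      linarith
    rw [← mul_div_assoc, div_le_iff₀ hp]
    calc (xs.length : ℝ) * T ≤ xs.length * (threshold p xs.length ε + 1) :=
          mul_le_mul_of_nonneg_left h2 (by linarith)
      _ = 12 * p * ellPrime ε + xs.length := by
          rw [threshold]
          have : (xs.length : ℝ) ≠ 0 := by linarith
          field_simp
      _ ≤ _ := by linarith
  have hmean : (Finset.univ.expect fun ω : Seed p d =>
      ((blockUpdate xs ω (numHashes ε) (threshold p xs.length ε)).time : ℝ)) ≤
      4 + 2 * numHashes ε + xs.length * (12 * (d + 1) + 56 * Nat.clog 2 (numHashes ε) + 41) +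
        39 * (xs.length * (numHashes ε * ((T : ℝ) / p))) := by
    have hsum : ∀ ω : Seed p d, (((xs.map (smallCount ω (numHashes ε) T)).sum : ℕ) : ℝ) =
        ∑ x ∈ xs.toFinset, (smallCount ω (numHashes ε) T x : ℝ) := fun ω => by
      rw [← List.sum_toFinset _ hn, Nat.cast_sum]
    calc _ ≤ Finset.univ.expect fun ω : Seed p d => ((4 + 2 * numHashes ε +
            xs.length * (12 * (d + 1) + 56 * Nat.clog 2 (numHashes ε) + 41) : ℝ) +
            39 * ∑ x ∈ xs.toFinset, (smallCount ω (numHashes ε) T x : ℝ)) := by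
          refine Finset.expect_le_expect fun ω _ => ?_
          rw [← hsum]
          exact_mod_cast blockUpdate_time xs ω (numHashes ε) (threshold p xs.length ε) hk
      _ = _ := by
          rw [Finset.expect_add_distrib, Finset.expect_const Finset.univ_nonempty,
            ← Finset.mul_expect, Finset.expect_sum_comm]
          simp only [expect_smallCount _ _ _ hTp]
          rw [Finset.sum_const, nsmul_eq_mul, List.toFinset_card_of_nodup hn]
  refine hmean.trans ?_
  have hdD : (d : ℝ) ≤ |D| * Real.logb 2 (1 / ε) :=
    hd.trans (mul_le_mul_of_nonneg_right (le_abs_self D) hL.le)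
  have hP : 1 ≤ 1 / ε ^ 2 := by
    rw [le_div_iff₀ (by positivity)]; nlinarith
  rw [ellPrime] at hTt
  rw [meanConst, blockTime]
  have hD0 := abs_nonneg D
  generalize |1 / Real.logb 2 (1 / ε₀)| = M at *
  generalize Real.logb 2 (1 / ε) = L at *
  generalize 1 / ε ^ 2 = P at *
  generalize |D| = D' at *
  generalize (Nat.clog 2 (numHashes ε) : ℝ) = c at *
  generalize (xs.length : ℝ) = b at *
  have hk0 : (0 : ℝ) ≤ numHashes ε := Nat.cast_nonneg _
  generalize (numHashes ε : ℝ) = k at *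
  generalize (T : ℝ) / p = q at *
  generalize (d : ℝ) = d' at *
  have hb0 : 0 ≤ b := by linarith
  have hP0 : 0 ≤ P := by linarith
  -- The cost per item, the small values, and the initialization are each bounded in terms of `L`.
  have b1 : b * (12 * (d' + 1) + 56 * c + 41) ≤ b * ((12 * D' + 333 * M + 112) * L) :=
    mul_le_mul_of_nonneg_left (by linarith) hb0
  have b2 : b * (k * q) ≤ 10 * P * ((961 * M + 24) * L) := by
    calc b * (k * q) = k * (b * q) := by ring
      _ ≤ k * ((961 * M + 24) * L) := mul_le_mul_of_nonneg_left (by linarith) hk0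
      _ ≤ _ := mul_le_mul_of_nonneg_right hk' (by positivity)
  have b3 : b ≤ b * (M * L) := le_mul_of_one_le_right hb0 hM
  have b4 : P ≤ P * (M * L) := le_mul_of_one_le_right hP0 hM
  have c1 : 0 ≤ D' * (P * L) := by positivity
  have c2 : 0 ≤ M * (b * L) := by positivity
  have c3 : 0 ≤ M * (P * L) := by positivity
  have c4 : 0 ≤ b * L := by positivity
  have c5 : 0 ≤ P * L := by positivity
  nlinarith

theorem unifProb_time_lt {ε ε₀ D : ℝ} {p d : ℕ} [Fact p.Prime] {xs : List ℕ} (h0 : 0 < ε)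
    (hε : ε ≤ ε₀) (h1 : ε₀ < 1) (hk : numHashes ε ≤ p) (hd : (d : ℝ) ≤ D * Real.logb 2 (1 / ε))
    (hne : xs ≠ []) (hn : xs.Nodup) (hx : ∀ x ∈ xs, x < p) :
    unifProb {ω : Seed p d | 101 * meanConst ε₀ D * blockTime xs.length ε <
      (blockUpdate xs ω (numHashes ε) (threshold p xs.length ε)).time} < 1 / 100 := by
  have h2 := (unifProb_mul_le_expect
    (E := {ω : Seed p d | 101 * meanConst ε₀ D * blockTime xs.length ε <
      (blockUpdate xs ω (numHashes ε) (threshold p xs.length ε)).time})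
    (X := fun ω => ((blockUpdate xs ω (numHashes ε) (threshold p xs.length ε)).time : ℝ))
    (c := 101 * meanConst ε₀ D * blockTime xs.length ε)
    (fun ω => Nat.cast_nonneg _) fun ω hω => le_of_lt hω).trans
    (expect_time_le h0 hε h1 hk hd hne hn hx)
  have h3 := mul_pos (meanConst_pos ε₀ D) (blockTime_pos h0 (hε.trans_lt h1) xs.length)
  generalize unifProb (Ω := Seed p d) _ = P at *
  have h4 : P * 101 ≤ 1 := by
    refine le_of_mul_le_mul_right ?_ h3
    linarith
  linarith

theorem Timed.within_time_le {α : Type} (B : ℕ) (c : Timed α) : (c.within B).time ≤ B := by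
  rw [Timed.within]; split_ifs with h
  · exact h
  · exact le_rfl

theorem mainTheorem6 (ε₀ D : ℝ) (hε₀ : ε₀ < 1) :
    ∃ C : ℝ, 0 < C ∧ ∀ δ₀ : ℝ, δ₀ < 1 → ∃ C₁ : ℝ, 0 < C₁ ∧
      ∀ (ε : ℝ) (u p d : ℕ) [Fact p.Prime] (xs : List ℕ),
        0 < ε → ε ≤ ε₀ →
        u < p → numHashes ε ≤ p →
        ellPrime ε < d → (d : ℝ) ≤ D * Real.logb 2 (1 / ε) →
        xs ≠ [] → xs.Nodup → (∀ x ∈ xs, 1 ≤ x ∧ x ≤ u) →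
        -- one block
        (unifProb {ω : Seed p d | ¬ IsBlockFingerprint xs ω (numHashes ε)
            (blockUpdate xs ω (numHashes ε) (threshold p xs.length ε)).val} < 1 / 2 ^ 29 ∧
          unifProb {ω : Seed p d | C * blockTime xs.length ε <
            (blockUpdate xs ω (numHashes ε) (threshold p xs.length ε)).time} < 1 / 100 ∧
          unifProb {ω : Seed p d | ¬ (IsBlockFingerprint xs ω (numHashes ε)
              (blockUpdate xs ω (numHashes ε) (threshold p xs.length ε)).val ∧
            ((blockUpdate xs ω (numHashes ε) (threshold p xs.length ε)).time : ℝ) ≤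
              C * blockTime xs.length ε)} < 1 / 2 ^ 29 + 1 / 100) ∧
        -- all blocks, where blocks that exceed the time bound are dropped
        ∀ δ : ℝ, 0 < δ → δ ≤ δ₀ →
          (∀ ω : Fin (numBlocks δ) → Seed p d,
            ((allBlocks xs ω (numHashes ε) (threshold p xs.length ε)
              ⌊C * blockTime xs.length ε⌋₊).time : ℝ) ≤
                C₁ * (Real.logb 2 (1 / δ) * blockTime xs.length ε)) ∧
          ∀ r : Fin (numBlocks δ),
            unifProb {ω : Fin (numBlocks δ) → Seed p d |
              ¬ ∃ s : BlockState,
                (allBlocks xs ω (numHashes ε) (threshold p xs.length ε)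
                  ⌊C * blockTime xs.length ε⌋₊).val r = some s ∧
                IsBlockFingerprint xs (ω r) (numHashes ε) s} < 1 / 2 ^ 29 + 1 / 100 := by
  have hC : 0 < 101 * meanConst ε₀ D := mul_pos (by norm_num) (meanConst_pos ε₀ D)
  refine ⟨101 * meanConst ε₀ D, hC, fun δ₀ hδ₀ =>
    ⟨101 * meanConst ε₀ D * (4 + |1 / Real.logb 2 (1 / δ₀)|), by positivity, ?_⟩⟩
  intro ε u p d _ xs h0 hε hu hk hd hdD hne hn hx
  have hx' : ∀ x ∈ xs, x < p := fun x h => ((hx x h).2).trans_lt hu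
  have h1 := hε.trans_lt hε₀
  have hA := unifProb_incorrect_lt h0 h1 hk hd hne hn hx'
  have hB := unifProb_time_lt h0 hε hε₀ hk hdD hne hn hx'
  have hbt := blockTime_pos h0 h1 xs.length
  have hAB : unifProb {ω : Seed p d | ¬ (IsBlockFingerprint xs ω (numHashes ε)
      (blockUpdate xs ω (numHashes ε) (threshold p xs.length ε)).val ∧
      ((blockUpdate xs ω (numHashes ε) (threshold p xs.length ε)).time : ℝ) ≤
        101 * meanConst ε₀ D * blockTime xs.length ε)} < 1 / 2 ^ 29 + 1 / 100 := by
    refine (unifProb_le_add fun ω hω => ?_).trans_lt (add_lt_add hA hB)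
    rcases not_and_or.1 hω with h | h
    · exact Or.inl h
    · exact Or.inr (not_le.1 h)
  refine ⟨⟨hA, hB, hAB⟩, fun δ hδ hδδ => ⟨fun ω => ?_, fun r => ?_⟩⟩
  · have hL := logb_one_div_pos hδ (hδδ.trans_lt hδ₀)
    have hM := one_le_mul_logb_one_div hδ hδδ hδ₀
    have hm : (numBlocks δ : ℝ) ≤ (4 + |1 / Real.logb 2 (1 / δ₀)|) * Real.logb 2 (1 / δ) := by
      have := (Nat.ceil_lt_add_one (a := 4 * Real.logb 2 (1 / δ)) (by positivity)).le
      rw [numBlocks]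
      linarith
    have hB' := Nat.floor_le (mul_pos hC hbt).le
    set B := ⌊101 * meanConst ε₀ D * blockTime xs.length ε⌋₊
    have hsum : (allBlocks xs ω (numHashes ε) (threshold p xs.length ε) B).time ≤
        numBlocks δ * B := by
      simp only [allBlocks]
      refine (Finset.sum_le_sum fun r _ => Timed.within_time_le B _).trans ?_
      simp
    calc ((allBlocks xs ω (numHashes ε) (threshold p xs.length ε) B).time : ℝ)
        ≤ (numBlocks δ : ℝ) * B := by exact_mod_cast hsum
      _ ≤ ((4 + |1 / Real.logb 2 (1 / δ₀)|) * Real.logb 2 (1 / δ)) *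
          (101 * meanConst ε₀ D * blockTime xs.length ε) :=
          mul_le_mul hm hB' (Nat.cast_nonneg _) (by positivity)
      _ = _ := by ring
  · rw [← unifProb_eval r] at hAB
    refine (unifProb_mono fun ω hω => ?_).trans_lt hAB
    rintro ⟨hfp, htime⟩
    refine hω ⟨_, ?_, hfp⟩
    simp only [allBlocks, Timed.within, if_pos (Nat.le_floor htime)]
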